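/- The Cyclic Graph Automorphism problem (CGA) is the following decision problem: given a (finite, simple, undirected) graph $\Gamma$ on $n$ vertices and a permutation $\sigma\in S_n$ of its vertices, decide whether the cyclic subgroup $\langle\sigma\rangle\le S_n$ contains a non-identity automorphism of $\Gamma$, i.e. whether there is an integer $k$ with $\sigma^k\neq 1$ such that, for all vertices $u,v$, $\{u,v\}$ is an edge of $\Gamma$ if and only if $\{\sigma^k(u),\sigma^k(v)\}$ is an edge of $\Gamma$. There is an efficient quantum algorithm for CGA, that is, CGA is in $\mathrm{BQP}$. Precisely: encode the instance $(\Gamma,\sigma)$ as a bit string of length $\Theta(n^2+1)$ that lists $n$, the adjacency matrix of $\Gamma$ and the values of $\sigma$. There is a deterministic Turing machine which, on the encoding of $(\Gamma,\sigma)$, writes down in time polynomial in the length of the encoding the description of a quantum circuit $Q_{\Gamma,\sigma}$ over the gate set $\{H,T,\mathrm{CNOT}\}$ such that, when $Q_{\Gamma,\sigma}$ is run on the all-zero state and its output qubit is measured in the computational basis, the outcome $1$ has probability at least $2/3$ if $\langle\sigma\rangle$ contains a non-identity automorphism of $\Gamma$, and probability at most $1/3$ otherwise. -/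

import Mathlib

/-! ### Bit strings -/

/-- The self-delimiting unary code `1 ⋯ 1 0` (with `k` ones) of a natural number `k`. -/
def unaryCode (k : ℕ) : List Bool := List.replicate k true ++ [false]

theorem unaryCode_append_inj {a b : ℕ} {x y : List Bool}
    (h : unaryCode a ++ x = unaryCode b ++ y) : a = b ∧ x = y := by
  induction a generalizing b with
  | zero =>
    cases b with
    | zero => simpa [unaryCode] using h
    | succ b => simp [unaryCode, List.replicate_succ] at h
  | succ a ih =>
    cases b with
    | zero => simp [unaryCode, List.replicate_succ] at h
    | succ b =>
      have h' : unaryCode a ++ x = unaryCode b ++ y := by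
        simpa [unaryCode, List.replicate_succ] using h
      obtain ⟨h1, h2⟩ := ih h'
      exact ⟨by rw [h1], h2⟩

theorem flatMap_unaryCode_inj {α : Type} {f g : α → ℕ} (l : List α)
    (h : l.flatMap (fun a => unaryCode (f a)) = l.flatMap (fun a => unaryCode (g a))) :
    ∀ a ∈ l, f a = g a := by
  induction l with
  | nil => simp
  | cons b l ih =>
    simp only [List.flatMap_cons] at h
    obtain ⟨h1, h2⟩ := unaryCode_append_inj h
    intro a ha
    rcases List.mem_cons.1 ha with rfl | ha
    · exact h1
    · exact ih h2 a ha

/-- An injective map into bit strings, as an encoding. -/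
noncomputable def encodingOfInjective {α : Type} (e : α → List Bool)
    (he : Function.Injective e) : Computability.Encoding α Bool where
  encode := e
  decode := Function.partialInv e
  decode_encode := Function.partialInv_left he

/-! ### Quantum circuits over the gate set {H, T, CNOT} -/

/-- The elementary gates that can be applied to a register of `w` qubits: a Hadamard gate on a
qubit, a `T` gate (π/8 gate) on a qubit, or a controlled-NOT with a control qubit `c` and a target
qubit `t ≠ c`. -/
inductive QGate (w : ℕ) where
  | hadamard (i : Fin w) : QGate w
  | tgate (i : Fin w) : QGate w
  | cnot (c t : Fin w) (hct : c ≠ t) : QGate w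

/-- The one-qubit Hadamard matrix. -/
noncomputable def hadamardMatrix : Matrix Bool Bool ℂ :=
  Matrix.of fun a b => if a && b then -(1 / (Real.sqrt 2 : ℂ)) else 1 / (Real.sqrt 2 : ℂ)

/-- The one-qubit `T` matrix `diag (1, exp (iπ/4))`. -/
noncomputable def tMatrix : Matrix Bool Bool ℂ :=
  Matrix.diagonal fun a => if a then Complex.exp (Real.pi / 4 * Complex.I) else 1

/-- The operator on `w` qubits that applies the one-qubit operator `A` to the `i`-th qubit and the
identity to the others, in the computational basis. -/
def onQubit {w : ℕ} (A : Matrix Bool Bool ℂ) (i : Fin w) :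
    Matrix (Fin w → Bool) (Fin w → Bool) ℂ :=
  Matrix.of fun x y => if ∀ j, j ≠ i → x j = y j then A (x i) (y i) else 0

/-- The unitary matrix of a gate on `w` qubits, in the computational basis. -/
noncomputable def QGate.matrix {w : ℕ} : QGate w → Matrix (Fin w → Bool) (Fin w → Bool) ℂ
  | .hadamard i => onQubit hadamardMatrix i
  | .tgate i => onQubit tMatrix i
  | .cnot c t _ => Matrix.of fun x y => if x = Function.update y t (xor (y t) (y c)) then 1 else 0

/-- The description of a gate as a bit string: two bits for its kind, followed by the unary codes
of the positions of the qubits that it acts on. -/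
def QGate.code {w : ℕ} : QGate w → List Bool
  | .hadamard i => [false, false] ++ unaryCode i
  | .tgate i => [false, true] ++ unaryCode i
  | .cnot c t _ => [true, true] ++ (unaryCode c ++ unaryCode t)

/-- A quantum circuit: a register of `extra + 1` qubits, of which qubit `0` is the output qubit,
and a finite sequence of elementary gates, the head of the list being applied first. -/
structure QCircuit where
  extra : ℕ
  gates : List (QGate (extra + 1))

namespace QCircuit

/-- The state vector that the circuit produces from the all-zero state. -/
noncomputable def finalState (C : QCircuit) : (Fin (C.extra + 1) → Bool) → ℂ :=
  C.gates.foldl (fun ψ g => g.matrix.mulVec ψ) (Pi.single (fun _ => false) 1)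

/-- The probability of the outcome `1` when the output qubit is measured at the end. -/
noncomputable def acceptProb (C : QCircuit) : ℝ :=
  ∑ x : Fin (C.extra + 1) → Bool, if x 0 = true then ‖C.finalState x‖ ^ 2 else 0

/-- The description of a circuit as a bit string: the number of qubits other than the output qubit
in unary, and then the descriptions of the gates. -/
def code (C : QCircuit) : List Bool :=
  unaryCode C.extra ++ C.gates.flatMap QGate.code

end QCircuit

theorem QGate.code_append_inj {w : ℕ} {g g' : QGate w} {x y : List Bool}
    (h : g.code ++ x = g'.code ++ y) : g = g' ∧ x = y := by
  cases g <;> cases g' <;> simp only [QGate.code, List.cons_append, List.nil_append,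
    List.append_assoc, List.cons.injEq, reduceCtorEq, false_and, and_false, true_and] at h
  · obtain ⟨h1, h2⟩ := unaryCode_append_inj h
    exact ⟨by rw [Fin.ext h1], h2⟩
  · obtain ⟨h1, h2⟩ := unaryCode_append_inj h
    exact ⟨by rw [Fin.ext h1], h2⟩
  · obtain ⟨h1, h2⟩ := unaryCode_append_inj h
    obtain ⟨h3, h4⟩ := unaryCode_append_inj h2
    refine ⟨?_, h4⟩
    obtain rfl := Fin.ext h1
    obtain rfl := Fin.ext h3
    rfl

theorem QGate.flatMap_code_injective {w : ℕ} :
    Function.Injective fun l : List (QGate w) => l.flatMap QGate.code := by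
  have hne : ∀ g : QGate w, g.code ≠ [] := by intro g; cases g <;> simp [QGate.code]
  intro l
  induction l with
  | nil =>
    intro l' h
    cases l' with
    | nil => rfl
    | cons g l' => simp [hne g] at h
  | cons g l ih =>
    intro l' h
    cases l' with
    | nil => simp [hne g] at h
    | cons g' l' =>
      simp only [List.flatMap_cons] at h
      obtain ⟨h1, h2⟩ := QGate.code_append_inj h
      rw [h1, ih h2]

theorem QCircuit.code_injective : Function.Injective QCircuit.code := by
  rintro ⟨m, l⟩ ⟨m', l'⟩ h
  obtain ⟨h1, h2⟩ := unaryCode_append_inj h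
  obtain rfl : m = m' := h1
  obtain rfl : l = l' := QGate.flatMap_code_injective h2
  rfl

/-- The encoding of quantum circuits as bit strings. -/
noncomputable def QCircuit.encoding : Computability.Encoding QCircuit Bool :=
  encodingOfInjective QCircuit.code QCircuit.code_injective

/-! ### The class BQP -/

/-- Membership in BQP (polynomial-time quantum algorithms with bounded error) of the decision
problem `P` about objects of type `α` that are given to the algorithm as bit strings via `e`: there
is a deterministic polynomial-time (multi-stack) Turing machine that, on the encoding of an instance
`a`, writes down the description of a quantum circuit `Q a` (so that the circuit has polynomially
many gates) such that, run on the all-zero state, `Q a` accepts with probability at least `2/3` if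
the answer on `a` is yes, and with probability at most `1/3` if the answer on `a` is no. -/
def InBQP {α : Type} (e : Computability.Encoding α Bool) (P : α → Prop) : Prop :=
  ∃ Q : α → QCircuit,
    Nonempty (Turing.TM2ComputableInPolyTime e.encode QCircuit.encoding.encode Q) ∧
    (∀ a, P a → 2 / 3 ≤ (Q a).acceptProb) ∧
    (∀ a, ¬ P a → (Q a).acceptProb ≤ 1 / 3)

/-! ### The Cyclic Graph Automorphism problem -/

/-- An instance of the Cyclic Graph Automorphism problem: a graph on `n` vertices and a permutation
in `S_n`. -/
structure CGAInstance where
  n : ℕ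
  graph : SimpleGraph (Fin n)
  perm : Equiv.Perm (Fin n)

namespace CGAInstance

/-- The answer to an instance: does the cyclic group generated by the permutation contain a
non-identity automorphism of the graph? -/
def HasCyclicAutomorphism (I : CGAInstance) : Prop :=
  ∃ τ : I.graph ≃g I.graph,
    (τ.toEquiv : Equiv.Perm (Fin I.n)) ∈ Subgroup.zpowers I.perm ∧
    (τ.toEquiv : Equiv.Perm (Fin I.n)) ≠ 1

open Classical in
/-- An instance as a bit string: the number of vertices in unary, then the adjacency matrix row by
row, then the values of the permutation in unary. The length is of the order of `n ^ 2`. -/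
noncomputable def code (I : CGAInstance) : List Bool :=
  unaryCode I.n ++
    ((List.finRange I.n ×ˢ List.finRange I.n).map (fun p => decide (I.graph.Adj p.1 p.2)) ++
      (List.finRange I.n).flatMap (fun u => unaryCode (I.perm u)))

theorem code_injective : Function.Injective code := by
  rintro ⟨n, G, σ⟩ ⟨n', G', σ'⟩ h
  obtain ⟨h1, h2⟩ := unaryCode_append_inj h
  obtain rfl : n = n' := h1
  obtain ⟨h3, h4⟩ := List.append_inj h2 (by simp)
  have hG : G = G' := by
    ext u v
    have := (List.map_inj_left.1 h3) (u, v) (by simp)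
    simpa using this
  have hσ : σ = σ' := by
    ext u
    exact flatMap_unaryCode_inj _ h4 u (List.mem_finRange u)
  rw [hG, hσ]

/-- The encoding of instances as bit strings. -/
noncomputable def encoding : Computability.Encoding CGAInstance Bool :=
  encodingOfInjective code code_injective

end CGAInstance

/-!
The Cyclic Graph Automorphism problem can be decided by a classical algorithm in polynomial time, so
the machine that has to describe a quantum circuit may solve the instance itself and describe a
circuit on a single qubit that produces the answer with certainty: no gates at all for `0`, and
`H T T T T H = X` for `1`.

Let `σ` be the permutation. The power `σ ^ k` preserves the graph if and only if, for all vertices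
`u` and `v`, the number `k` is a multiple of the least period `d(u, v)` of the binary sequence that
tells whether `σ ^ i u` and `σ ^ i v` are adjacent, and `σ ^ k` moves the vertex `w` if and only if
`k` is not a multiple of the length `ℓ(w)` of the cycle of `w`. Hence a cyclic automorphism exists
if and only if some `ℓ(w)` does not divide the least common multiple of all `d(u, v)`. That multiple
may be exponentially large, but only its greatest common divisor with `ℓ(w)` matters: the condition
holds if and only if there is a positive `g < ℓ(w)` which is divisible by all common divisors of
`ℓ(w)` with one of the `d(u, v)` (`exists_forall_dvd_and_not_dvd_iff`,
`CGAInstance.hasCyclicAutomorphism_iff`). As `ℓ(w) ≤ n` and `d(u, v) ≤ n ^ 2`, all numbers involved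
are bounded by the length of the encoding, and exhaustive search settles the question.

To turn this into a Turing machine, `Cmd` is a small structured programming language on stacks,
which multi-stack machines simulate step by step (`Cmd.Runs.simulate`, `Cmd.nonempty_polyTime`). On
top of it, `Comp` is the class of the functions whose values do not exceed the length of the input
word and which such programs compute on unary numbers in polynomial time. The class is closed under
bounded iteration (`Comp.fold`); since no member can exceed the length of the input, iterations may
be nested without leaving polynomial time. Therefore it contains truncated arithmetic, bounded
search and bounded quantification, and the criterion above, read off the encoding, is one of its
conditions (`CompP.criterion`, `CGAInstance.criterion_code`).
-/

/-! ### Structured programs on stacks -/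

/-- Structured programs acting on countably many stacks of bits. `case k e t f` pops stack `k` and
continues with `e` if it was empty, and with `t` or `f` according to the bit popped otherwise;
`loop k t f` pops stack `k` and runs `t` or `f` according to the bit popped, until stack `k` is
found empty. -/
inductive Cmd where
  | skip : Cmd
  | push (k : ℕ) (b : Bool) : Cmd
  | seq (a b : Cmd) : Cmd
  | case (k : ℕ) (e t f : Cmd) : Cmd
  | loop (k : ℕ) (t f : Cmd) : Cmd

namespace Cmd

/-- `Runs c s s' t`: started on the stacks `s`, the program `c` terminates on the stacks `s'`
after exactly `t` steps. -/
inductive Runs : Cmd → (ℕ → List Bool) → (ℕ → List Bool) → ℕ → Prop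
  | skip (s) : Runs .skip s s 1
  | push (k b s) : Runs (.push k b) s (Function.update s k (b :: s k)) 1
  | seq {a b s s' s'' m n} : Runs a s s' m → Runs b s' s'' n → Runs (.seq a b) s s'' (m + n)
  | case_nil {k e t f s s' n} : s k = [] → Runs e s s' n → Runs (.case k e t f) s s' (n + 1)
  | case_cons {k e t f s s' n} (b r) : s k = b :: r →
      Runs (bif b then t else f) (Function.update s k r) s' n → Runs (.case k e t f) s s' (n + 1)
  | loop_nil {k t f s} : s k = [] → Runs (.loop k t f) s s 1
  | loop_cons {k t f s s' s'' m n} (b r) : s k = b :: r →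
      Runs (bif b then t else f) (Function.update s k r) s' m →
      Runs (.loop k t f) s' s'' n → Runs (.loop k t f) s s'' (m + n + 1)

/-- All stacks that the program mentions have an index of at most `N`. -/
def BoundedBy (N : ℕ) : Cmd → Prop
  | skip => True
  | push k _ => k ≤ N
  | seq a b => a.BoundedBy N ∧ b.BoundedBy N
  | case k e t f => k ≤ N ∧ e.BoundedBy N ∧ t.BoundedBy N ∧ f.BoundedBy N
  | loop k t f => k ≤ N ∧ t.BoundedBy N ∧ f.BoundedBy N

theorem BoundedBy.mono {N M : ℕ} (h : N ≤ M) : ∀ {c : Cmd}, c.BoundedBy N → c.BoundedBy M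
  | skip, _ => trivial
  | push _ _, hc => le_trans hc h
  | seq _ _, hc => ⟨hc.1.mono h, hc.2.mono h⟩
  | case _ _ _ _, hc => ⟨hc.1.trans h, hc.2.1.mono h, hc.2.2.1.mono h, hc.2.2.2.mono h⟩
  | loop _ _ _, hc => ⟨hc.1.trans h, hc.2.1.mono h, hc.2.2.mono h⟩

theorem exists_boundedBy : ∀ c : Cmd, ∃ N, c.BoundedBy N
  | skip => ⟨0, trivial⟩
  | push k _ => ⟨k, le_refl k⟩
  | seq a b => by
    obtain ⟨N, hN⟩ := exists_boundedBy a
    obtain ⟨M, hM⟩ := exists_boundedBy b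
    exact ⟨max N M, hN.mono (by omega), hM.mono (by omega)⟩
  | case k e t f => by
    obtain ⟨N, hN⟩ := exists_boundedBy e
    obtain ⟨M, hM⟩ := exists_boundedBy t
    obtain ⟨P, hP⟩ := exists_boundedBy f
    exact ⟨max (max N M) (max P k), by omega, hN.mono (by omega), hM.mono (by omega),
      hP.mono (by omega)⟩
  | loop k t f => by
    obtain ⟨M, hM⟩ := exists_boundedBy t
    obtain ⟨P, hP⟩ := exists_boundedBy f
    exact ⟨max M (max P k), by omega, hM.mono (by omega), hP.mono (by omega)⟩

/-! ### Translation into multi-stack Turing machines -/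

/-- The labels of the machine that executes a program: one for each node of its syntax tree, except
that a sequence has no label of its own. -/
def Label : Cmd → Type
  | skip => Unit
  | push _ _ => Unit
  | seq a b => a.Label ⊕ b.Label
  | case _ e t f => Unit ⊕ (e.Label ⊕ (t.Label ⊕ f.Label))
  | loop _ t f => Unit ⊕ (t.Label ⊕ f.Label)

noncomputable instance fintypeLabel : (c : Cmd) → Fintype c.Label
  | skip => inferInstanceAs (Fintype Unit)
  | push _ _ => inferInstanceAs (Fintype Unit)
  | seq a b =>
    haveI := fintypeLabel a
    haveI := fintypeLabel b
    inferInstanceAs (Fintype (a.Label ⊕ b.Label))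
  | case _ e t f =>
    haveI := fintypeLabel e
    haveI := fintypeLabel t
    haveI := fintypeLabel f
    inferInstanceAs (Fintype (Unit ⊕ (e.Label ⊕ (t.Label ⊕ f.Label))))
  | loop _ t f =>
    haveI := fintypeLabel t
    haveI := fintypeLabel f
    inferInstanceAs (Fintype (Unit ⊕ (t.Label ⊕ f.Label)))

/-- The label at which the execution of a program starts. -/
def entry : (c : Cmd) → c.Label
  | skip => ()
  | push _ _ => ()
  | seq a _ => Sum.inl a.entry
  | case _ _ _ _ => Sum.inl ()
  | loop _ _ _ => Sum.inl ()

/-- Statements of a machine with stacks `0, …, N` of bits whose internal state can hold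
the outcome of a pop. -/
abbrev MStmt (N : ℕ) (Λ : Type) : Type :=
  Turing.TM2.Stmt (fun _ : Fin (N + 1) => Bool) Λ (Option Bool)

/-- Pop stack `k`, and jump according to the outcome; the internal state is reset before the jump,
so that it has its initial value at every label. -/
def popStmt {N : ℕ} {Λ : Type} (k : ℕ) (e t f : Λ) : MStmt N Λ :=
  .pop (Fin.ofNat (N + 1) k) (fun _ o => o)
    (.branch (fun v => v.isNone) (.load (fun _ => none) (.goto fun _ => e))
      (.branch (fun v => v.getD false) (.load (fun _ => none) (.goto fun _ => t))
        (.load (fun _ => none) (.goto fun _ => f))))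

/-- The statements of the machine that executes a program, whose labels are embedded by `emb` into
those of a larger machine, and which jumps to `exit` in the end. -/
def stmt {N : ℕ} {Λ : Type} : (c : Cmd) → (emb : c.Label → Λ) → (exit : Λ) → c.Label → MStmt N Λ
  | skip, _, exit, _ => .goto fun _ => exit
  | push k b, _, exit, _ => .push (Fin.ofNat (N + 1) k) (fun _ => b) (.goto fun _ => exit)
  | seq a b, emb, exit, l => match l with
    | .inl l => a.stmt (fun l => emb (.inl l)) (emb (.inr b.entry)) l
    | .inr l => b.stmt (fun l => emb (.inr l)) exit l
  | case k e t f, emb, exit, l => match l with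
    | .inl _ => popStmt k (emb (.inr (.inl e.entry))) (emb (.inr (.inr (.inl t.entry))))
        (emb (.inr (.inr (.inr f.entry))))
    | .inr (.inl l) => e.stmt (fun l => emb (.inr (.inl l))) exit l
    | .inr (.inr (.inl l)) => t.stmt (fun l => emb (.inr (.inr (.inl l)))) exit l
    | .inr (.inr (.inr l)) => f.stmt (fun l => emb (.inr (.inr (.inr l)))) exit l
  | loop k t f, emb, exit, l => match l with
    | .inl _ => popStmt k exit (emb (.inr (.inl t.entry))) (emb (.inr (.inr f.entry)))
    | .inr (.inl l) => t.stmt (fun l => emb (.inr (.inl l))) (emb (.inl ())) l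
    | .inr (.inr l) => f.stmt (fun l => emb (.inr (.inr l))) (emb (.inl ())) l

section Simulation

variable {N : ℕ} {Λ : Type}

/-- The configuration at label `l` whose stacks are the first `N + 1` stacks of `s`. -/
def cfgAt (l : Option Λ) (s : ℕ → List Bool) :
    Turing.TM2.Cfg (fun _ : Fin (N + 1) => Bool) Λ (Option Bool) :=
  ⟨l, none, fun j => s j⟩

theorem val_ofNat {k : ℕ} (hk : k ≤ N) : (Fin.ofNat (N + 1) k).val = k :=
  Nat.mod_eq_of_lt (Nat.lt_succ_of_le hk)

theorem update_ofNat {k : ℕ} (hk : k ≤ N) (s : ℕ → List Bool) (x : List Bool) :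
    Function.update (fun j : Fin (N + 1) => s j) (Fin.ofNat (N + 1) k) x =
      fun j : Fin (N + 1) => Function.update s k x j := by
  funext j
  by_cases h : (j : ℕ) = k
  · obtain rfl : j = Fin.ofNat (N + 1) k := Fin.ext (by rw [val_ofNat hk, h])
    rw [Function.update_self, h, Function.update_self]
  · have : j ≠ Fin.ofNat (N + 1) k := fun h' => h (by rw [h', val_ofNat hk])
    rw [Function.update_of_ne this, Function.update_of_ne h]

theorem apply_ofNat {k : ℕ} (hk : k ≤ N) (s : ℕ → List Bool) :
    s (Fin.ofNat (N + 1) k : Fin (N + 1)) = s k := by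
  rw [val_ofNat hk]

theorem stepAux_popStmt_nil {k : ℕ} (hk : k ≤ N) {s : ℕ → List Bool} (hs : s k = [])
    (e t f : Λ) :
    Turing.TM2.stepAux (popStmt k e t f) none (fun j : Fin (N + 1) => s j) = cfgAt (some e) s := by
  simp only [popStmt, Turing.TM2.stepAux, apply_ofNat hk, hs, update_ofNat hk, cfgAt]
  simp only [List.head?_nil, List.tail_nil, Option.isNone_none, cond_true,
    Turing.TM2.Cfg.mk.injEq, true_and]
  funext j
  rw [← hs, Function.update_eq_self]

theorem stepAux_popStmt_cons {k : ℕ} (hk : k ≤ N) {s : ℕ → List Bool} {b : Bool} {r : List Bool}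
    (hs : s k = b :: r) (e t f : Λ) :
    Turing.TM2.stepAux (popStmt k e t f) none (fun j : Fin (N + 1) => s j) =
      cfgAt (some (bif b then t else f)) (Function.update s k r) := by
  simp only [popStmt, Turing.TM2.stepAux, apply_ofNat hk, hs, update_ofNat hk, cfgAt]
  cases b <;> simp

theorem iterate_bind_add {α : Type} (f : α → Option α) {a b : α} {c : Option α} {m n : ℕ}
    (h₁ : (flip bind f)^[m] (some a) = some b) (h₂ : (flip bind f)^[n] (some b) = c) :
    (flip bind f)^[m + n] (some a) = c := by
  rw [Nat.add_comm, Function.iterate_add_apply, h₁, h₂]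

theorem iterate_bind_succ {α : Type} (f : α → Option α) {a b : α} {c : Option α} {n : ℕ}
    (h₁ : f a = some b) (h₂ : (flip bind f)^[n] (some b) = c) :
    (flip bind f)^[n + 1] (some a) = c := by
  rw [Function.iterate_succ_apply, ← h₂, ← h₁]
  rfl

/-- A terminating run of a program is simulated, step by step, by every machine that contains the
statements of the program. -/
theorem Runs.simulate {c : Cmd} {s s' : ℕ → List Bool} {t : ℕ} (h : Runs c s s' t) :
    ∀ (M : Λ → MStmt N Λ) (emb : c.Label → Λ) (exit : Λ), c.BoundedBy N →
      (∀ l, M (emb l) = c.stmt emb exit l) →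
      (flip bind (Turing.TM2.step M))^[t] (some (cfgAt (some (emb c.entry)) s)) =
        some (cfgAt (some exit) s') := by
  have one : ∀ (M : Λ → MStmt N Λ) (l : Λ) (s : ℕ → List Bool),
      Turing.TM2.step M (cfgAt (some l) s) =
        some (Turing.TM2.stepAux (M l) none (fun j : Fin (N + 1) => s j)) := fun _ _ _ => rfl
  induction h with
  | skip s =>
    intro M emb exit _ hM
    refine iterate_bind_succ _ ((one _ _ _).trans ?_) rfl
    rw [hM]
    rfl
  | push k b s =>
    intro M emb exit hb hM
    refine iterate_bind_succ _ ((one _ _ _).trans ?_) rfl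
    rw [hM]
    simp only [stmt, Turing.TM2.stepAux, apply_ofNat hb, update_ofNat hb, cfgAt]
  | @seq a b _ _ _ _ _ _ _ ih₁ ih₂ =>
    intro M emb exit hb hM
    exact iterate_bind_add _
      (ih₁ M (fun l => emb (.inl l)) (emb (.inr b.entry)) hb.1 fun l => hM (.inl l))
      (ih₂ M (fun l => emb (.inr l)) exit hb.2 fun l => hM (.inr l))
  | @case_nil k e t f s _ _ hs _ ih =>
    intro M emb exit hb hM
    refine iterate_bind_succ _ ?_
      (ih M (fun l => emb (.inr (.inl l))) exit hb.2.1 fun l => hM (.inr (.inl l)))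
    rw [one, show M (emb (case k e t f).entry) = _ from hM _]
    exact congrArg some (stepAux_popStmt_nil hb.1 hs _ _ _)
  | @case_cons k e t f s _ _ b r hs _ ih =>
    intro M emb exit hb hM
    cases b with
    | true =>
      refine iterate_bind_succ _ ?_ (ih M (fun l => emb (.inr (.inr (.inl l)))) exit hb.2.2.1
        fun l => hM (.inr (.inr (.inl l))))
      rw [one, show M (emb (case k e t f).entry) = _ from hM _]
      exact congrArg some (stepAux_popStmt_cons hb.1 hs _ _ _)
    | false =>
      refine iterate_bind_succ _ ?_ (ih M (fun l => emb (.inr (.inr (.inr l)))) exit hb.2.2.2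
        fun l => hM (.inr (.inr (.inr l))))
      rw [one, show M (emb (case k e t f).entry) = _ from hM _]
      exact congrArg some (stepAux_popStmt_cons hb.1 hs _ _ _)
  | @loop_nil k t f s hs =>
    intro M emb exit hb hM
    refine iterate_bind_succ _ ?_ rfl
    rw [one, show M (emb (loop k t f).entry) = _ from hM _]
    exact congrArg some (stepAux_popStmt_nil hb.1 hs _ _ _)
  | @loop_cons k t f s _ _ _ _ b r hs _ _ ih₁ ih₂ =>
    intro M emb exit hb hM
    cases b with
    | true =>
      refine iterate_bind_succ _ ?_ (iterate_bind_add _ (ih₁ M (fun l => emb (.inr (.inl l)))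
        (emb (.inl ())) hb.2.1 fun l => hM (.inr (.inl l))) (ih₂ M emb exit hb hM))
      rw [one, show M (emb (loop k t f).entry) = _ from hM _]
      exact congrArg some (stepAux_popStmt_cons hb.1 hs _ _ _)
    | false =>
      refine iterate_bind_succ _ ?_ (iterate_bind_add _ (ih₁ M (fun l => emb (.inr (.inr l)))
        (emb (.inl ())) hb.2.2 fun l => hM (.inr (.inr l))) (ih₂ M emb exit hb hM))
      rw [one, show M (emb (loop k t f).entry) = _ from hM _]
      exact congrArg some (stepAux_popStmt_cons hb.1 hs _ _ _)

end Simulation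

/-- The machine with stacks `0, …, N + 1` that executes a program and halts; stack `0` holds the
input and stack `1` the output. -/
noncomputable def machine (N : ℕ) (c : Cmd) : Turing.FinTM2 where
  K := Fin (N + 1 + 1)
  k₀ := ⟨0, by omega⟩
  k₁ := ⟨1, by omega⟩
  Γ _ := Bool
  Λ := Option c.Label
  main := some c.entry
  σ := Option Bool
  initialState := none
  Γk₀Fin := inferInstanceAs (Fintype Bool)
  m l := match l with
    | none => .halt
    | some l => c.stmt some none l

/-- A program that replaces the input on stack `0` by the output on stack `1` in polynomial time
gives a polynomial-time Turing machine. -/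
theorem nonempty_polyTime {α β : Type} {ea : α → List Bool} {eb : β → List Bool} {g : α → β}
    (c : Cmd) (p : Polynomial ℕ)
    (h : ∀ a, ∃ t ≤ p.eval (ea a).length,
      Runs c (Function.update (fun _ => []) 0 (ea a))
        (Function.update (fun _ => []) 1 (eb (g a))) t) :
    Nonempty (Turing.TM2ComputableInPolyTime ea eb g) := by
  obtain ⟨N, hN⟩ := c.exists_boundedBy
  refine ⟨{
    tm := machine N c
    inputAlphabet := Equiv.refl Bool
    outputAlphabet := Equiv.refl Bool
    -- One step is spent on the `halt` statement.
    time := p + 1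
    outputsFun := fun a => ?_ }⟩
  have hrun : ∃ t ≤ (p + 1 : Polynomial ℕ).eval (ea a).length,
      (flip bind (machine N c).step)^[t]
        (some (Turing.initList (machine N c) (List.map (Equiv.refl Bool).invFun (ea a)))) =
      some (Turing.haltList (machine N c) (List.map (Equiv.refl Bool).invFun (eb (g a)))) := by
    obtain ⟨t, ht, hr⟩ := h a
    refine ⟨t + 1, by simpa using ht, ?_⟩
    have h₁ := hr.simulate (N := N + 1) (machine N c).m some none (hN.mono (Nat.le_succ N))
      (fun l => rfl)
    have hinit : Turing.initList (machine N c) (List.map (Equiv.refl Bool).invFun (ea a)) =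
        cfgAt (N := N + 1) (some (some c.entry)) (Function.update (fun _ => []) 0 (ea a)) := by
      simp only [Turing.initList, cfgAt]
      congr 1
      funext j
      by_cases hj : j = (⟨0, by omega⟩ : Fin (N + 1 + 1))
      · subst hj
        have e : Function.update (fun _ : ℕ => ([] : List Bool)) 0 (ea a) 0 = (ea a) :=
          Function.update_self ..
        exact (dif_pos rfl).trans ((List.map_id (ea a)).trans e.symm)
      · have : (j : Fin (N + 1 + 1)).val ≠ 0 := fun h' => hj (Fin.ext h')
        have e : Function.update (fun _ : ℕ => ([] : List Bool)) 0 (ea a) j.val = [] :=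
          Function.update_of_ne this ..
        exact (dif_neg hj).trans e.symm
    have hhalt : Turing.haltList (machine N c) (List.map (Equiv.refl Bool).invFun (eb (g a))) =
        cfgAt (N := N + 1) none (Function.update (fun _ => []) 1 (eb (g a))) := by
      simp only [Turing.haltList, cfgAt]
      congr 1
      funext j
      by_cases hj : j = (⟨1, by omega⟩ : Fin (N + 1 + 1))
      · subst hj
        have e : Function.update (fun _ : ℕ => ([] : List Bool)) 1 (eb (g a)) 1 = (eb (g a)) :=
          Function.update_self ..
        exact (dif_pos rfl).trans ((List.map_id (eb (g a))).trans e.symm)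
      · have : (j : Fin (N + 1 + 1)).val ≠ 1 := fun h' => hj (Fin.ext h')
        have e : Function.update (fun _ : ℕ => ([] : List Bool)) 1 (eb (g a)) j.val = [] :=
          Function.update_of_ne this ..
        exact (dif_neg hj).trans e.symm
    rw [hinit, hhalt]
    exact iterate_bind_add _ h₁ rfl
  exact ⟨⟨hrun.choose, hrun.choose_spec.2⟩, hrun.choose_spec.1⟩

end Cmd

/-! ### Moving the contents of stacks -/

namespace Cmd

theorem Runs.congr {c : Cmd} {s s' s'' : ℕ → List Bool} {t : ℕ} (h : Runs c s s' t)
    (e : s' = s'') : Runs c s s'' t := e ▸ h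

/-- Empty stack `i`. -/
def clear (i : ℕ) : Cmd := loop i skip skip

theorem runs_clear {i : ℕ} (l : List Bool) : ∀ {s : ℕ → List Bool}, s i = l →
    Runs (clear i) s (Function.update s i []) (2 * l.length + 1) := by
  induction l with
  | nil =>
    intro s h
    refine (Runs.loop_nil h).congr ?_
    rw [← h, Function.update_eq_self]
  | cons b l ih =>
    intro s h
    have h₁ := ih (s := Function.update s i l) (by simp)
    have h₂ : Runs (bif b then skip else skip) (Function.update s i l)
        (Function.update s i l) 1 := by
      cases b <;> exact .skip _
    have := Runs.loop_cons b l h h₂ h₁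
    rw [show 2 * (b :: l).length + 1 = 1 + (2 * l.length + 1) + 1 by simp; ring]
    exact this.congr (by simp)

/-- Move the content of stack `i` to the top of stack `j`, one bit at a time. -/
def move (i j : ℕ) : Cmd := loop i (push j true) (push j false)

theorem runs_move {i j : ℕ} (hij : i ≠ j) (l : List Bool) : ∀ {s : ℕ → List Bool}, s i = l →
    Runs (move i j) s (Function.update (Function.update s i []) j (l.reverse ++ s j))
      (2 * l.length + 1) := by
  induction l with
  | nil =>
    intro s h
    refine (Runs.loop_nil h).congr ?_
    funext m
    simp only [Function.update_apply]
    split_ifs <;> simp_all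
  | cons b l ih =>
    intro s h
    have h₁ := ih (s := Function.update (Function.update s i l) j (b :: (Function.update s i l) j))
      (by simp [hij])
    have := Runs.loop_cons b l h (by cases b <;> exact .push j _ _) h₁
    rw [show 2 * (b :: l).length + 1 = 1 + (2 * l.length + 1) + 1 by simp; ring]
    refine this.congr ?_
    funext k
    simp only [Function.update_apply]
    split_ifs <;> simp_all

/-- Move the content of stack `i` to the top of stack `k`, one bit at a time, and push a `1` on
stack `j` for each of these bits. -/
def tally (i j k : ℕ) : Cmd :=
  loop i (seq (push k true) (push j true)) (seq (push k false) (push j true))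

theorem runs_tally {i j k : ℕ} (hij : i ≠ j) (hik : i ≠ k) (hjk : j ≠ k) (l : List Bool) :
    ∀ {s : ℕ → List Bool}, s i = l →
    Runs (tally i j k) s (Function.update (Function.update (Function.update s i []) k
      (l.reverse ++ s k)) j (List.replicate l.length true ++ s j)) (3 * l.length + 1) := by
  induction l with
  | nil =>
    intro s h
    refine (Runs.loop_nil h).congr ?_
    funext m
    simp only [Function.update_apply]
    split_ifs <;> simp_all
  | cons b l ih =>
    intro s h
    have h₁ := ih (s := Function.update (Function.update (Function.update s i l) k (b :: s k))
      j (true :: s j)) (by simp [hij, hik])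
    have h₂ : Runs
        (bif b then seq (push k true) (push j true) else seq (push k false) (push j true))
        (Function.update s i l) (Function.update (Function.update (Function.update s i l) k
          (b :: s k)) j (true :: s j)) 2 := by
      cases b <;> refine ((Runs.push k _ _).seq (.push j true _)).congr ?_ <;>
        simp [hij.symm, hik.symm, hjk]
    have := Runs.loop_cons b l h h₂ h₁
    rw [show 3 * (b :: l).length + 1 = 2 + (3 * l.length + 1) + 1 by simp; ring]
    refine this.congr ?_
    funext m
    simp only [Function.update_apply]
    split_ifs <;> simp_all [List.replicate_succ']

end Cmd

/-! ### Length-bounded functions computable in polynomial time -/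

/-- A type whose elements consist of a nonempty input word and a fixed number of natural numbers
(the values of the variables `0, …, size - 1`). -/
class Ctx (α : Type) where
  word : α → List Bool
  size : ℕ
  val : α → ℕ → ℕ
  length_pos : ∀ x, 0 < (word x).length

namespace Ctx

variable {α : Type} [Ctx α]

/-- The length of the input word, which bounds the values of all variables. -/
def len (x : α) : ℕ := (word x).length

/-- The values of the variables are bounded by the length of the input word. -/
def Valid (x : α) : Prop := ∀ j < size α, val x j ≤ len x

/-- The context extended by one more variable. -/
instance : Ctx (α × ℕ) where
  word x := word x.1
  size := size α + 1
  val x j := if j = size α then x.2 else val x.1 j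
  length_pos x := length_pos x.1

@[simp] theorem len_mk (x : α) (i : ℕ) : len (x, i) = len x := rfl

theorem valid_mk {x : α} {i : ℕ} : Valid (x, i) ↔ Valid x ∧ i ≤ len x := by
  constructor
  · intro h
    refine ⟨fun j hj => ?_, ?_⟩
    · have := h j (Nat.lt_succ_of_lt hj)
      simpa [val, hj.ne] using this
    · simpa [val] using h (size α) (Nat.lt_succ_self _)
  · rintro ⟨h, hi⟩ j hj
    by_cases hj' : j = size α
    · simpa [val, hj'] using hi
    · simpa [val, hj'] using h j (lt_of_le_of_ne (Nat.lt_succ_iff.1 hj) hj')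

/-- The stacks `s` represent `x`: stack `0` holds the input word, stack `p j` holds the value of
variable `j` in unary, and the stacks `D, D + 1, …` are empty. -/
structure Repr (p : ℕ → ℕ) (D : ℕ) (x : α) (s : ℕ → List Bool) : Prop where
  word : s 0 = word x
  val : ∀ j < size α, s (p j) = List.replicate (val x j) true
  empty : ∀ i, D ≤ i → s i = []

/-- The places `p` of the variables lie below `D` and avoid the input stack. -/
def Places (α : Type) [Ctx α] (p : ℕ → ℕ) (D : ℕ) : Prop :=
  1 ≤ D ∧ ∀ j < size α, 1 ≤ p j ∧ p j < D

theorem Places.succ {p : ℕ → ℕ} {D : ℕ} (h : Places α p D) : Places α p (D + 1) :=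
  ⟨by have := h.1; omega, fun j hj => by have := h.2 j hj; omega⟩

theorem Places.extend {p : ℕ → ℕ} {D : ℕ} (h : Places α p D) :
    Places (α × ℕ) (Function.update p (size α) D) (D + 1) := by
  refine ⟨by have := h.1; omega, fun j hj => ?_⟩
  by_cases hj' : j = size α
  · subst hj'
    have := h.1
    simp [this]
  · have := h.2 j (lt_of_le_of_ne (Nat.lt_succ_iff.1 hj) hj')
    simp only [Function.update_of_ne hj']
    omega

theorem Repr.update {p : ℕ → ℕ} {D : ℕ} {x : α} {s : ℕ → List Bool} (h : Repr p D x s)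
    (hp : Places α p D) (l : List Bool) : Repr p (D + 1) x (Function.update s D l) where
  word := by
    have := hp.1
    rw [Function.update_of_ne (by omega), h.word]
  val j hj := by
    have := hp.2 j hj
    rw [Function.update_of_ne (by omega), h.val j hj]
  empty i hi := by rw [Function.update_of_ne (by omega), h.empty i (by omega)]

theorem Repr.extend {p : ℕ → ℕ} {D : ℕ} {x : α} {s : ℕ → List Bool} (h : Repr p D x s)
    (hp : Places α p D) (i : ℕ) :
    Repr (α := α × ℕ) (Function.update p (size α) D) (D + 1) (x, i)
      (Function.update s D (List.replicate i true)) where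
  word := (h.update hp _).word
  val j hj := by
    by_cases hj' : j = size α
    · simp [hj', Ctx.val]
    · have hj'' : j < size α := lt_of_le_of_ne (Nat.lt_succ_iff.1 hj) hj'
      have := hp.2 j hj''
      simp only [Function.update_of_ne hj', Ctx.val, if_neg hj']
      exact (h.update hp _).val j hj''
  empty := (h.update hp _).empty

end Ctx

open Ctx

/-- `f` is bounded by the length of the input word, and it can be computed on stacks in polynomial
time: wherever the variables are placed, there is a program which pushes the value of `f` in unary
on the first free stack and leaves the other stacks as they were. -/
def Comp {α : Type} [Ctx α] (f : α → ℕ) : Prop :=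
  (∀ x, Valid x → f x ≤ len x) ∧
  ∀ p D, Places α p D → ∃ (c : Cmd) (P : Polynomial ℕ), ∀ x s, Valid x → Repr p D x s →
    ∃ t ≤ P.eval (len x), Cmd.Runs c s (Function.update s D (List.replicate (f x) true)) t

/-- `foldDown g n a` applies `g (n - 1)`, …, `g 1`, `g 0` in this order to `a`. -/
def foldDown (g : ℕ → ℕ → ℕ) : ℕ → ℕ → ℕ
  | 0, a => a
  | n + 1, a => foldDown g n (g n a)

namespace Comp

variable {α : Type} [Ctx α]

theorem le {f : α → ℕ} (h : Comp f) {x : α} (hx : Valid x) : f x ≤ len x := h.1 x hx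

/-- Only the values on valid contexts matter. -/
theorem congr {f g : α → ℕ} (h : Comp f) (e : ∀ x, Valid x → f x = g x) : Comp g := by
  refine ⟨fun x hx => e x hx ▸ h.1 x hx, fun p D hp => ?_⟩
  obtain ⟨c, P, hc⟩ := h.2 p D hp
  exact ⟨c, P, fun x s hx hs => e x hx ▸ hc x s hx hs⟩

/-- Copying stack `i` in unary. -/
theorem exists_copy {i D : ℕ} (hi : i < D) : ∃ c : Cmd, ∀ s : ℕ → List Bool,
    s D = [] → s (D + 1) = [] →
    Cmd.Runs c s (Function.update s D (List.replicate (s i).length true))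
      (5 * (s i).length + 2) := by
  refine ⟨.seq (.tally i D (D + 1)) (.move (D + 1) i), fun s h₀ h₁ => ?_⟩
  have r₁ := Cmd.runs_tally (i := i) (j := D) (k := D + 1) (by omega) (by omega) (by omega) (s i)
    (s := s) rfl
  have r₂ := Cmd.runs_move (i := D + 1) (j := i) (by omega) (s i).reverse
    (s := Function.update (Function.update (Function.update s i []) (D + 1)
      ((s i).reverse ++ s (D + 1))) D (List.replicate (s i).length true ++ s D)) (by simp [h₁])
  have := r₁.seq r₂
  rw [show 5 * (s i).length + 2 = 3 * (s i).length + 1 + (2 * (s i).reverse.length + 1) by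
    simp; ring]
  refine this.congr ?_
  funext m
  simp only [Function.update_apply]
  split_ifs <;> first | omega | simp_all

theorem length : Comp (fun x : α => len x) := by
  refine ⟨fun x _ => le_rfl, fun p D hp => ?_⟩
  obtain ⟨c, hc⟩ := exists_copy (i := 0) (D := D) hp.1
  refine ⟨c, 5 * .X + 2, fun x s hx hs => ⟨5 * len x + 2, by simp, ?_⟩⟩
  have := hc s (hs.empty _ le_rfl) (hs.empty _ (by omega))
  rwa [hs.word] at this

theorem var {j : ℕ} (hj : j < size α) : Comp (fun x : α => val x j) := by
  refine ⟨fun x hx => hx j hj, fun p D hp => ?_⟩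
  obtain ⟨c, hc⟩ := exists_copy (hp.2 j hj).2
  refine ⟨c, 5 * .X + 2, fun x s hx hs => ⟨5 * val x j + 2, ?_, ?_⟩⟩
  · have := hx j hj
    simp only [Polynomial.eval_add, Polynomial.eval_mul, Polynomial.eval_ofNat, Polynomial.eval_X]
    omega
  · have := hc s (hs.empty _ le_rfl) (hs.empty _ (by omega))
    rwa [hs.val j hj, List.length_replicate] at this

theorem snd : Comp (fun x : α × ℕ => x.2) :=
  (var (α := α × ℕ) (Nat.lt_succ_self (size α))).congr fun x _ => by simp [val]

/-- A function of a context may be regarded as one of an extended context. -/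
theorem weaken {f : α → ℕ} (h : Comp f) : Comp (fun x : α × ℕ => f x.1) := by
  refine ⟨fun x hx => h.1 x.1 (valid_mk.1 hx).1, fun p D hp => ?_⟩
  obtain ⟨c, P, hc⟩ := h.2 p D ⟨hp.1, fun j hj => hp.2 j (Nat.lt_succ_of_lt hj)⟩
  refine ⟨c, P, fun x s hx hs => hc x.1 s (valid_mk.1 hx).1 ⟨hs.word, fun j hj => ?_, hs.empty⟩⟩
  have := hs.val j (Nat.lt_succ_of_lt hj)
  simpa [val, hj.ne] using this

theorem pred {f : α → ℕ} (h : Comp f) : Comp (fun x => f x - 1) := by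
  refine ⟨fun x hx => (Nat.sub_le _ _).trans (h.1 x hx), fun p D hp => ?_⟩
  obtain ⟨c, P, hc⟩ := h.2 p D hp
  refine ⟨.seq c (.case D .skip .skip .skip), P + 2, fun x s hx hs => ?_⟩
  obtain ⟨t, ht, hr⟩ := hc x s hx hs
  refine ⟨t + (1 + 1), by simpa using ht, hr.seq ?_⟩
  cases hf : f x with
  | zero =>
    refine .case_nil (by simp) ((Cmd.Runs.skip _).congr ?_)
    simp [hf]
  | succ n =>
    refine .case_cons true (List.replicate n true) (by simp [List.replicate_succ])
      ((Cmd.Runs.skip _).congr ?_)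
    simp [hf]

theorem ite {f g h : α → ℕ} (hf : Comp f) (hg : Comp g) (hh : Comp h) :
    Comp (fun x => if f x = 0 then h x else g x) := by
  refine ⟨fun x hx => ?_, fun p D hp => ?_⟩
  · dsimp only
    split_ifs
    exacts [hh.1 x hx, hg.1 x hx]
  obtain ⟨c, P, hc⟩ := hf.2 p D hp
  obtain ⟨c₁, P₁, hc₁⟩ := hg.2 p D hp
  obtain ⟨c₂, P₂, hc₂⟩ := hh.2 p D hp
  -- The last branch is never taken, because a number in unary consists of ones.
  refine ⟨.seq c (.case D c₂ (.seq (.clear D) c₁) .skip), P + (P₁ + P₂ + 2 * .X + 2),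
    fun x s hx hs => ?_⟩
  obtain ⟨t, ht, hr⟩ := hc x s hx hs
  obtain ⟨t₁, ht₁, hr₁⟩ := hc₁ x s hx hs
  obtain ⟨t₂, ht₂, hr₂⟩ := hc₂ x s hx hs
  have hs' : Function.update s D [] = s := by rw [← hs.empty D le_rfl, Function.update_eq_self]
  have hb := hf.1 x hx
  cases hfx : f x with
  | zero =>
    refine ⟨t + (t₂ + 1), ?_, hr.seq (.case_nil (by simp [hfx]) ?_)⟩
    · simp; omega
    · rw [hfx, List.replicate_zero, hs']
      exact hr₂.congr (by simp [hfx])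
  | succ n =>
    refine ⟨t + ((2 * n + 1 + t₁) + 1), ?_, hr.seq (.case_cons true (List.replicate n true)
      (by simp [hfx, List.replicate_succ]) ?_)⟩
    · simp; omega
    · have hres : (if f x = 0 then h x else g x) = g x := if_neg (by omega)
      simp only [Function.update_idem, cond_true, hres]
      have := Cmd.runs_clear (i := D) (List.replicate n true)
        (s := Function.update s D (List.replicate n true)) (by simp)
      rw [List.length_replicate, Function.update_idem, hs'] at this
      exact this.seq hr₁

/-- The bit of the input word at a given position, `0` beyond the end of the word. -/
theorem bit {f : α → ℕ} (h : Comp f) :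
    Comp (fun x => ((word x)[f x]?.getD false).toNat) := by
  refine ⟨fun x _ => ?_, fun p D hp => ?_⟩
  · exact (Bool.toNat_le _).trans (length_pos x)
  obtain ⟨c, P, hc⟩ := h.2 p D hp
  have hD := hp.1
  -- Move one bit from the input stack to stack `D + 1`; in a loop driven by stack `D`, this is
  -- done `f x` times.
  let shift : Cmd := .case 0 .skip (.push (D + 1) true) (.push (D + 1) false)
  -- Read the next bit of the input, leaving it in place.
  let look : Cmd := .case 0 .skip (.seq (.push 0 true) (.push D true)) (.push 0 false)
  have hshift : ∀ (n : ℕ) (s : ℕ → List Bool), s D = List.replicate n true →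
      Cmd.Runs (.loop D shift shift) s (Function.update (Function.update (Function.update s D [])
        (D + 1) (((s 0).take n).reverse ++ s (D + 1))) 0 ((s 0).drop n)) (3 * n + 1) := by
    intro n
    induction n with
    | zero =>
      intro s hs
      refine (Cmd.Runs.loop_nil hs).congr ?_
      have hs' : Function.update s D [] = s := by
        rw [← show s D = [] from hs, Function.update_eq_self]
      simp [hs']
    | succ n ih =>
      intro s hs
      have step : Cmd.Runs shift (Function.update s D (List.replicate n true))
          (Function.update (Function.update (Function.update s D (List.replicate n true))
            (D + 1) (((s 0).take 1).reverse ++ s (D + 1))) 0 ((s 0).drop 1)) 2 := by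
        cases h0 : s 0 with
        | nil =>
          refine (Cmd.Runs.case_nil ?_ (.skip _)).congr ?_
          · rw [Function.update_of_ne (by omega), h0]
          · funext m
            simp only [Function.update_apply]
            split_ifs <;> simp_all
        | cons b r =>
          have e0 : Function.update s D (List.replicate n true) 0 = b :: r := by
            rw [Function.update_of_ne (by omega), h0]
          refine (Cmd.Runs.case_cons b r e0 (s' := Function.update (Function.update
            (Function.update s D (List.replicate n true)) 0 r) (D + 1) (b :: s (D + 1)))
            (n := 1) ?_).congr ?_
          · cases b
            all_goals
              refine (Cmd.Runs.push (D + 1) _ _).congr ?_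
              congr 1
              simp
          · funext m
            simp only [Function.update_apply]
            split_ifs <;> simp_all
      have := ih _ (show Function.update (Function.update (Function.update s D
        (List.replicate n true)) (D + 1) (((s 0).take 1).reverse ++ s (D + 1))) 0
          ((s 0).drop 1) D = List.replicate n true by
        rw [Function.update_of_ne (by omega), Function.update_of_ne (by omega),
          Function.update_self])
      have := Cmd.Runs.loop_cons true (List.replicate n true)
        (by rw [hs, List.replicate_succ]) step this
      rw [show 3 * (n + 1) + 1 = 2 + (3 * n + 1) + 1 by ring]
      refine this.congr ?_
      cases h0 : s 0 with
      | nil =>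
        funext m
        simp only [Function.update_apply]
        split_ifs <;> simp_all
      | cons b r =>
        funext m
        simp only [Function.update_apply]
        split_ifs <;> simp_all
  refine ⟨.seq c (.seq (.loop D shift shift) (.seq look (.move (D + 1) 0))),
    P + (5 * .X + 5), fun x s hx hs => ?_⟩
  obtain ⟨t, ht, hr⟩ := hc x s hx hs
  have hb := h.1 x hx
  have e₁ := hs.empty D le_rfl
  have e₂ := hs.empty (D + 1) (by omega)
  have r₁ := hshift (f x) _ (Function.update_self D (List.replicate (f x) true) s)
  set w := word x with hw
  set s₁ := Function.update (Function.update s (D + 1) (w.take (f x)).reverse) 0 (w.drop (f x))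
    with hs₁
  have hs₁' : Function.update (Function.update (Function.update (Function.update s D
      (List.replicate (f x) true)) D []) (D + 1) (((Function.update s D
      (List.replicate (f x) true) 0).take (f x)).reverse ++ Function.update s D
      (List.replicate (f x) true) (D + 1))) 0 ((Function.update s D
      (List.replicate (f x) true) 0).drop (f x)) = s₁ := by
    have := hs.word
    funext m
    simp only [hs₁, Function.update_apply]
    split_ifs <;> first | omega | simp_all
  rw [hs₁'] at r₁
  have r₂ : ∃ t ≤ 3, Cmd.Runs look s₁
      (Function.update s₁ D (List.replicate (w[f x]?.getD false).toNat true)) t := by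
    have e₃ : s₁ 0 = w.drop (f x) := by simp [hs₁]
    have e₄ : s₁ D = [] := by
      rw [hs₁, Function.update_of_ne (by omega), Function.update_of_ne (by omega), e₁]
    have e₅ : (w.drop (f x)).head? = w[f x]? := by simp
    cases hd : w.drop (f x) with
    | nil =>
      rw [hd] at e₃ e₅
      refine ⟨2, by omega, (Cmd.Runs.case_nil e₃ (.skip _)).congr ?_⟩
      rw [← e₅, List.head?_nil, Option.getD_none, Bool.toNat_false, List.replicate_zero, ← e₄,
        Function.update_eq_self]
    | cons b r =>
      rw [hd] at e₃ e₅
      rw [← e₅, List.head?_cons, Option.getD_some]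
      clear_value s₁
      cases b with
      | true =>
        refine ⟨3, le_rfl, (Cmd.Runs.case_cons true r e₃ ((Cmd.Runs.push _ _ _).seq
          (.push _ _ _))).congr ?_⟩
        funext m
        simp only [Function.update_apply]
        split_ifs <;> first | omega | simp_all
      | false =>
        refine ⟨2, by omega, (Cmd.Runs.case_cons false r e₃ (Cmd.Runs.push _ _ _)).congr ?_⟩
        funext m
        simp only [Function.update_apply]
        split_ifs <;> first | omega | simp_all
  obtain ⟨t₂, ht₂, r₂⟩ := r₂
  have r₃ := Cmd.runs_move (i := D + 1) (j := 0) (by omega) (w.take (f x)).reverse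
    (s := Function.update s₁ D (List.replicate (w[f x]?.getD false).toNat true)) (by
      rw [Function.update_of_ne (by omega), hs₁, Function.update_of_ne (by omega),
        Function.update_self])
  refine ⟨_, ?_, (hr.seq (r₁.seq (r₂.seq r₃))).congr ?_⟩
  · have : (w.take (f x)).length ≤ f x := by simp
    simp only [List.length_reverse, Polynomial.eval_add, Polynomial.eval_mul,
      Polynomial.eval_ofNat, Polynomial.eval_X]
    omega
  · have e₃ : s₁ 0 = w.drop (f x) := by simp [hs₁]
    funext m
    by_cases h0 : m = 0
    · subst h0
      rw [Function.update_self, Function.update_of_ne (by omega), e₃, List.reverse_reverse,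
        List.take_append_drop, Function.update_of_ne (by omega), hs.word]
    · by_cases h1 : m = D + 1
      · subst h1
        rw [Function.update_of_ne h0, Function.update_self, Function.update_of_ne (by omega), e₂]
      · simp [Function.update_apply, h0, h1, hs₁, hw]

/-- Closure under bounded iteration, which is the source of all loops. The index of the iteration is
the unary counter that drives the loop, on stack `D`; the accumulator is on stack `D + 1`. As both
stay below the length of the input, the loop takes polynomial time. -/
theorem fold {n a : α → ℕ} {f : (α × ℕ) × ℕ → ℕ} (hn : Comp n) (ha : Comp a) (hf : Comp f) :
    Comp (fun x => foldDown (fun i acc => f ((x, i), acc)) (n x) (a x)) := by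
  have bound : ∀ x, Valid x → ∀ n acc, n ≤ len x → acc ≤ len x →
      foldDown (fun i acc => f ((x, i), acc)) n acc ≤ len x := by
    intro x hx n
    induction n with
    | zero => exact fun acc _ h => h
    | succ n ih =>
      intro acc hn hacc
      exact ih _ (by omega) (hf.1 ((x, n), acc) (valid_mk.2 ⟨valid_mk.2 ⟨hx, by omega⟩, hacc⟩))
  refine ⟨fun x hx => bound x hx _ _ (hn.1 x hx) (ha.1 x hx), fun p D hp => ?_⟩
  obtain ⟨c, P, hc⟩ := hn.2 p D hp
  obtain ⟨c₁, P₁, hc₁⟩ := ha.2 p (D + 1) hp.succ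
  obtain ⟨c₂, P₂, hc₂⟩ := hf.2 _ (D + 1 + 1) hp.extend.extend
  let body : Cmd := .seq c₂ (.seq (.clear (D + 1)) (.move (D + 1 + 1) (D + 1)))
  have loop : ∀ x s, Valid x → Repr p D x s → ∀ n acc, n ≤ len x → acc ≤ len x →
      ∃ t ≤ n * (P₂.eval (len x) + 4 * len x + 3) + 1,
        Cmd.Runs (.loop D body .skip)
          (Function.update (Function.update s D (List.replicate n true)) (D + 1)
            (List.replicate acc true))
          (Function.update (Function.update s D []) (D + 1)
            (List.replicate (foldDown (fun i acc => f ((x, i), acc)) n acc) true)) t := by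
    intro x s hx hs n
    induction n with
    | zero =>
      intro acc _ _
      refine ⟨1, by omega, .loop_nil ?_⟩
      rw [Function.update_of_ne (by omega), Function.update_self, List.replicate_zero]
    | succ n ih =>
      intro acc hn hacc
      have hv : Valid ((x, n), acc) := valid_mk.2 ⟨valid_mk.2 ⟨hx, by omega⟩, hacc⟩
      have hres := hf.1 _ hv
      obtain ⟨t₂, ht₂, r₂⟩ := hc₂ _ _ hv ((hs.extend hp n).extend hp.extend acc)
      obtain ⟨t₃, ht₃, r₃⟩ := ih (f ((x, n), acc)) (by omega) hres
      have e₁ := hs.empty D le_rfl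
      have e₂ := hs.empty (D + 1) (by omega)
      have e₃ := hs.empty (D + 1 + 1) (by omega)
      have r₄ := Cmd.runs_clear (i := D + 1) (List.replicate acc true)
        (s := Function.update (Function.update (Function.update s D (List.replicate n true))
          (D + 1) (List.replicate acc true)) (D + 1 + 1)
            (List.replicate (f ((x, n), acc)) true)) (by
          rw [Function.update_of_ne (by omega), Function.update_self])
      have r₅ := Cmd.runs_move (i := D + 1 + 1) (j := D + 1) (by omega)
        (List.replicate (f ((x, n), acc)) true)
        (s := Function.update (Function.update (Function.update (Function.update s D
          (List.replicate n true)) (D + 1) (List.replicate acc true)) (D + 1 + 1)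
            (List.replicate (f ((x, n), acc)) true)) (D + 1) []) (by
          rw [Function.update_of_ne (by omega), Function.update_self])
      have r₆ := (r₂.seq (r₄.seq r₅)).congr (s'' := Function.update (Function.update s D
          (List.replicate n true)) (D + 1) (List.replicate (f ((x, n), acc)) true)) (by
        funext m
        simp only [Function.update_apply]
        split_ifs <;> first | omega | simp_all)
      have e₄ : Function.update (Function.update s D (List.replicate n true)) (D + 1)
          (List.replicate acc true) = Function.update (Function.update (Function.update s D
            (List.replicate (n + 1) true)) (D + 1) (List.replicate acc true)) D
              (List.replicate n true) := by
        rw [Function.update_comm (a := D + 1) (b := D) (by omega), Function.update_idem]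
      refine ⟨_, ?_, Cmd.Runs.loop_cons true (List.replicate n true) ?_
        (e₄ ▸ r₆) r₃⟩
      · have : len ((x, n), acc) = len x := rfl
        rw [this] at ht₂ hres
        simp only [List.length_replicate]
        have : (n + 1) * (P₂.eval (len x) + 4 * len x + 3) =
          n * (P₂.eval (len x) + 4 * len x + 3) + (P₂.eval (len x) + 4 * len x + 3) := by ring
        omega
      · rw [Function.update_of_ne (by omega), Function.update_self, List.replicate_succ]
  refine ⟨.seq c (.seq c₁ (.seq (.loop D body .skip) (.move (D + 1) D))),
    P + P₁ + .X * (P₂ + 4 * .X + 3) + 2 * .X + 2, fun x s hx hs => ?_⟩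
  obtain ⟨t, ht, r⟩ := hc x s hx hs
  obtain ⟨t₁, ht₁, r₁⟩ := hc₁ x _ hx (hs.update hp (List.replicate (n x) true))
  obtain ⟨t₂, ht₂, r₂⟩ := loop x s hx hs (n x) (a x) (hn.1 x hx) (ha.1 x hx)
  have hb := bound x hx _ _ (hn.1 x hx) (ha.1 x hx)
  have r₃ := Cmd.runs_move (i := D + 1) (j := D) (by omega)
    (List.replicate (foldDown (fun i acc => f ((x, i), acc)) (n x) (a x)) true)
    (s := Function.update (Function.update s D []) (D + 1)
      (List.replicate (foldDown (fun i acc => f ((x, i), acc)) (n x) (a x)) true)) (by simp)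
  refine ⟨_, ?_, (r.seq (r₁.seq (r₂.seq r₃))).congr ?_⟩
  · have : n x * (P₂.eval (len x) + 4 * len x + 3) ≤ len x * (P₂.eval (len x) + 4 * len x + 3) :=
      Nat.mul_le_mul_right _ (hn.1 x hx)
    simp only [List.length_replicate, Polynomial.eval_add, Polynomial.eval_mul,
      Polynomial.eval_ofNat, Polynomial.eval_X]
    omega
  · have e₂ := hs.empty (D + 1) (by omega)
    funext m
    simp only [Function.update_apply]
    split_ifs <;> first | omega | simp_all

end Comp

/-! ### Closure properties -/

theorem foldDown_const (g : ℕ → ℕ) (n a : ℕ) : foldDown (fun _ acc => g acc) n a = g^[n] a := by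
  induction n generalizing a with
  | zero => rfl
  | succ n ih => exact ih (g a)

/-- The sum, truncated at `L`. -/
def satAdd (L a b : ℕ) : ℕ := min (a + b) L

/-- The product, truncated at `L`. -/
def satMul (L a b : ℕ) : ℕ := min (a * b) L

/-- The condition `p` is decided by a length-bounded function computable in polynomial time. -/
def CompP {α : Type} [Ctx α] (p : α → Prop) : Prop :=
  ∃ f : α → ℕ, Comp f ∧ ∀ x, Valid x → (p x ↔ f x ≠ 0)

open Classical in
/-- The least `i < n` such that `p i`, and `n` if there is none. As the iteration descends, the last
value recorded is the least one. -/
noncomputable def least (p : ℕ → Prop) (n : ℕ) : ℕ :=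
  foldDown (fun i acc => if p i then i else acc) n n

open Classical in
theorem foldDown_ite_of_forall_not {p : ℕ → Prop} {m : ℕ} (acc : ℕ) (h : ∀ j < m, ¬ p j) :
    foldDown (fun i acc => if p i then i else acc) m acc = acc := by
  induction m generalizing acc with
  | zero => rfl
  | succ m ih =>
    rw [foldDown, if_neg (h m (Nat.lt_succ_self m))]
    exact ih _ fun j hj => h j (Nat.lt_succ_of_lt hj)

theorem least_of_forall_not {p : ℕ → Prop} {n : ℕ} (h : ∀ j < n, ¬ p j) : least p n = n :=
  foldDown_ite_of_forall_not n h

open Classical in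
theorem least_eq {p : ℕ → Prop} {n k : ℕ} (hk : k < n) (hp : p k) (hlt : ∀ j < k, ¬ p j) :
    least p n = k := by
  have above : ∀ m acc, k < m → foldDown (fun i acc => if p i then i else acc) m acc = k := by
    intro m
    induction m with
    | zero => intro _ h; omega
    | succ m ih =>
      intro acc h
      rcases Nat.lt_succ_iff_lt_or_eq.1 h with h | rfl
      · exact ih _ h
      · rw [foldDown, if_pos hp]
        exact foldDown_ite_of_forall_not _ hlt
  exact above n n hk

namespace Comp

variable {α : Type} [Ctx α] {f g n a : α → ℕ}

/-- A function of a context and an accumulator, regarded as a function of a context, an index and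
an accumulator. -/
theorem weakenMid {f : α × ℕ → ℕ} (h : Comp f) : Comp (fun y : (α × ℕ) × ℕ => f (y.1.1, y.2)) := by
  have hv : ∀ y : (α × ℕ) × ℕ, Valid y → Valid (y.1.1, y.2) := fun y hy =>
    valid_mk.2 ⟨(valid_mk.1 (valid_mk.1 hy).1).1, (valid_mk.1 hy).2⟩
  refine ⟨fun y hy => h.1 _ (hv y hy), fun p D hp => ?_⟩
  obtain ⟨c, P, hc⟩ := h.2 (Function.update p (size α) (p (size α + 1))) D
    ⟨hp.1, fun j hj => by
      by_cases hj' : j = size α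
      · rw [hj', Function.update_self]
        exact hp.2 (size α + 1) (Nat.lt_succ_self _)
      · rw [Function.update_of_ne hj']
        exact hp.2 j (Nat.lt_succ_of_lt hj)⟩
  refine ⟨c, P, fun y s hy hs => hc (y.1.1, y.2) s (hv y hy) ⟨hs.word, fun j hj => ?_, hs.empty⟩⟩
  by_cases hj' : j = size α
  · have := hs.val (size α + 1) (Nat.lt_succ_self _)
    rw [hj', Function.update_self, this]
    simp [val, size]
  · rw [Function.update_of_ne hj', hs.val j (Nat.lt_succ_of_lt hj)]
    have : j ≠ size (α × ℕ) := Nat.ne_of_lt hj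
    simp [val, hj', this]

theorem iterate {F : α → ℕ → ℕ} (hn : Comp n) (ha : Comp a)
    (hF : Comp fun y : α × ℕ => F y.1 y.2) : Comp (fun x => (F x)^[n x] (a x)) :=
  (fold hn ha hF.weakenMid).congr fun x _ => foldDown_const (F x) _ _

theorem sub (hf : Comp f) (hg : Comp g) : Comp (fun x => f x - g x) := by
  refine (iterate (F := fun _ i => i - 1) hg hf snd.pred).congr fun x _ => ?_
  generalize g x = m
  induction m with
  | zero => rfl
  | succ m ih => rw [Function.iterate_succ_apply', ih]; omega

theorem zero : Comp (fun _ : α => 0) :=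
  (sub length length).congr fun _ _ => Nat.sub_self _

theorem one : Comp (fun _ : α => 1) :=
  (sub length length.pred).congr fun x _ => by
    have := length_pos x
    simp only [len]
    omega

/-- Length-bounded sums, obtained by counting down from the length of the input. -/
theorem satAdd (hf : Comp f) (hg : Comp g) : Comp (fun x => satAdd (len x) (f x) (g x)) :=
  (sub length (sub (sub length hf) hg)).congr fun x hx => by
    have := hf.le hx
    simp only [_root_.satAdd]
    omega

theorem satMul (hf : Comp f) (hg : Comp g) : Comp (fun x => satMul (len x) (f x) (g x)) := by
  refine (iterate (F := fun x i => _root_.satAdd (len x) i (f x)) hg zero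
    (satAdd snd hf.weaken)).congr fun x _ => ?_
  generalize g x = m
  induction m with
  | zero => simp [_root_.satMul]
  | succ m ih =>
    rw [Function.iterate_succ_apply', ih]
    simp only [_root_.satMul, _root_.satAdd, Nat.mul_succ]
    omega

theorem ite_prop {p : α → Prop} [DecidablePred p] (hp : CompP p) (hf : Comp f) (hg : Comp g) :
    Comp (fun x => if p x then f x else g x) := by
  obtain ⟨e, he, h⟩ := hp
  refine (ite he hf hg).congr fun x hx => ?_
  have := h x hx
  by_cases hpx : p x
  · rw [if_pos hpx, if_neg (this.1 hpx)]
  · rw [if_neg hpx, if_pos (not_not.1 fun h' => hpx (this.2 h'))]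

theorem least {p : α → ℕ → Prop} (hn : Comp n) (hp : CompP fun y : α × ℕ => p y.1 y.2) :
    Comp (fun x => least (p x) (n x)) := by
  have hp' : CompP fun y : (α × ℕ) × ℕ => p y.1.1 y.1.2 := by
    obtain ⟨f, hf, h⟩ := hp
    exact ⟨_, hf.weaken, fun y hy => h y.1 (valid_mk.1 hy).1⟩
  classical
  refine (fold hn hn (ite_prop hp' snd.weaken snd)).congr fun x _ => ?_
  unfold _root_.least
  congr!

end Comp

namespace CompP

variable {α : Type} [Ctx α] {f g n : α → ℕ} {p q : α → Prop}

theorem congr (h : CompP p) (e : ∀ x, Valid x → (p x ↔ q x)) : CompP q := by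
  obtain ⟨f, hf, hp⟩ := h
  exact ⟨f, hf, fun x hx => (e x hx).symm.trans (hp x hx)⟩

theorem not (hp : CompP p) : CompP (fun x => ¬ p x) := by
  classical
  exact ⟨_, Comp.ite_prop hp .zero .one, fun x _ => by by_cases h : p x <;> simp [h]⟩

theorem and (hp : CompP p) (hq : CompP q) : CompP (fun x => p x ∧ q x) := by
  classical
  exact ⟨_, Comp.ite_prop hp (Comp.ite_prop hq .one .zero) .zero, fun x _ => by
    by_cases h : p x <;> by_cases h' : q x <;> simp [h, h']⟩

theorem imp (hp : CompP p) (hq : CompP q) : CompP (fun x => p x → q x) :=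
  (hp.and hq.not).not.congr fun x _ => by tauto

theorem iff (hp : CompP p) (hq : CompP q) : CompP (fun x => p x ↔ q x) :=
  ((hp.imp hq).and (hq.imp hp)).congr fun x _ => by tauto

theorem lt (hf : Comp f) (hg : Comp g) : CompP (fun x => f x < g x) :=
  ⟨_, hg.sub hf, fun x _ => by omega⟩

theorem le (hf : Comp f) (hg : Comp g) : CompP (fun x => f x ≤ g x) :=
  (lt hg hf).not.congr fun _ _ => not_lt

theorem eq (hf : Comp f) (hg : Comp g) : CompP (fun x => f x = g x) :=
  ((le hf hg).and (le hg hf)).congr fun x _ => by omega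

theorem bit (hf : Comp f) : CompP (fun x => (word x)[f x]? = some true) :=
  ⟨_, hf.bit, fun x _ => by
    cases h : (word x)[f x]? with
    | none => simp [h]
    | some b => cases b <;> simp [h]⟩

/-- Bounded search: a witness exists if and only if the least one is below the bound. -/
theorem exists_lt {p : α → ℕ → Prop} (hn : Comp n) (hp : CompP fun y : α × ℕ => p y.1 y.2) :
    CompP (fun x => ∃ i < n x, p x i) := by
  refine (lt (hn.least hp) hn).congr fun x _ => ⟨fun h => ?_, fun ⟨i, hi, h⟩ => ?_⟩
  · by_contra hne
    push Not at hne
    rw [least_of_forall_not hne] at h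
    omega
  · classical
    have hex : ∃ i, p x i := ⟨i, h⟩
    have hmin : Nat.find hex ≤ i := Nat.find_min' hex h
    rw [least_eq (hmin.trans_lt hi) (Nat.find_spec hex) fun j hj => Nat.find_min hex hj]
    omega

theorem forall_lt {p : α → ℕ → Prop} (hn : Comp n) (hp : CompP fun y : α × ℕ => p y.1 y.2) :
    CompP (fun x => ∀ i < n x, p x i) :=
  (exists_lt (p := fun x i => ¬ p x i) hn hp.not).not.congr fun x _ => by push Not; rfl

theorem dvd (hf : Comp f) (hg : Comp g) : CompP (fun x => f x ∣ g x) := by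
  classical
  -- Counting up to `g x` and resetting the counter whenever it reaches `f x` computes the
  -- remainder.
  have succ : Comp fun y : α × ℕ => satAdd (len y.1) y.2 1 := Comp.satAdd .snd .one
  have h : Comp fun x => (fun i => if satAdd (len x) i 1 = f x then 0 else
      satAdd (len x) i 1)^[g x] 0 :=
    Comp.iterate (F := fun x i => if satAdd (len x) i 1 = f x then 0 else satAdd (len x) i 1)
      hg .zero (Comp.ite_prop (eq succ hf.weaken) .zero succ)
  refine (eq h .zero).congr fun x hx => ?_
  have key : ∀ m ≤ len x, (fun i => if satAdd (len x) i 1 = f x then 0 else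
      satAdd (len x) i 1)^[m] 0 = m % f x := by
    intro m
    induction m with
    | zero => simp
    | succ m ih =>
      intro hm
      have hle := Nat.mod_le m (f x)
      rw [Function.iterate_succ_apply', ih (by omega),
        show satAdd (len x) (m % f x) 1 = m % f x + 1 by simp only [satAdd]; omega]
      rcases Nat.eq_zero_or_pos (f x) with h0 | h0
      · simp [h0]
      · have hlt := Nat.mod_lt m h0
        rw [Nat.add_mod_eq_ite]
        by_cases h1 : f x = 1
        · simp [h1, Nat.mod_one]
        · rw [Nat.mod_eq_of_lt (show 1 < f x by omega)]
          split_ifs <;> omega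
  rw [key _ (hg.le hx), Nat.dvd_iff_mod_eq_zero]

end CompP

/-! ### Writing the answer -/

namespace Cmd

/-- Push a word on stack `i`, so that its head ends up on top. -/
def pushList (i : ℕ) : List Bool → Cmd
  | [] => skip
  | b :: l => seq (pushList i l) (push i b)

theorem runs_pushList (i : ℕ) (l : List Bool) (s : ℕ → List Bool) :
    Runs (pushList i l) s (Function.update s i (l ++ s i)) (l.length + 1) := by
  induction l with
  | nil => exact (Runs.skip s).congr (by simp)
  | cons b l ih => exact (ih.seq (.push i b _)).congr (by simp)

end Cmd

open Classical in
/-- A machine that decides a condition in polynomial time can write down either of two prescribed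
words according to the answer. -/
theorem CompP.nonempty_polyTime {α β : Type} [Ctx α] (hα : size α = 0) {p : α → Prop}
    (hp : CompP p) (eb : β → List Bool) (yes no : β) :
    Nonempty (Turing.TM2ComputableInPolyTime (word (α := α)) eb
      (fun x => if p x then yes else no)) := by
  obtain ⟨f, hf, hpf⟩ := hp
  obtain ⟨c, P, hc⟩ := hf.2 id 1 ⟨le_rfl, fun j hj => by omega⟩
  refine Cmd.nonempty_polyTime (.seq c (.seq (.clear 0) (.case 1 (.pushList 1 (eb no))
    (.seq (.clear 1) (.pushList 1 (eb yes))) .skip)))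
    (P + 4 * .X + 10 + .C (eb yes).length + .C (eb no).length) fun x => ?_
  have hx : Valid x := fun j hj => by omega
  set s₀ : ℕ → List Bool := Function.update (fun _ => []) 0 (word x) with hs₀
  have hr : Repr id 1 x s₀ := by
    refine ⟨by simp [hs₀], fun j hj => by omega, fun i hi => ?_⟩
    rw [hs₀, Function.update_of_ne (by omega)]
  obtain ⟨t, ht, r⟩ := hc x s₀ hx hr
  have hle := hf.le hx
  have r₁ := Cmd.runs_clear (i := 0) (word x)
    (s := Function.update s₀ 1 (List.replicate (f x) true)) (by simp [hs₀])
  have e₁ : Function.update (Function.update s₀ 1 (List.replicate (f x) true)) 0 [] =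
      Function.update (fun _ => []) 1 (List.replicate (f x) true) := by
    funext m
    simp only [hs₀, Function.update_apply]
    split_ifs <;> first | omega | rfl
  rw [e₁] at r₁
  have hlen : (word x).length = len x := rfl
  by_cases h : p x
  · obtain ⟨n, hn⟩ := Nat.exists_eq_succ_of_ne_zero ((hpf x hx).1 h)
    have r₂ := Cmd.runs_clear (i := 1) (List.replicate n true)
      (s := Function.update (fun _ => []) 1 (List.replicate n true)) (by simp)
    have r₃ := Cmd.runs_pushList 1 (eb yes) (fun _ => [])
    rw [Function.update_idem, show Function.update (fun _ : ℕ => ([] : List Bool)) 1 [] =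
      fun _ => [] from Function.update_eq_self 1 _] at r₂
    refine ⟨_, ?_, r.seq (r₁.seq (.case_cons true (List.replicate n true)
      (by simp [hn, List.replicate_succ]) (s' := Function.update (fun _ => []) 1 (eb yes))
      (n := 2 * (List.replicate n true).length + 1 + ((eb yes).length + 1)) ?_)) |>.congr ?_⟩
    · simp only [List.length_replicate, Polynomial.eval_add, Polynomial.eval_mul,
        Polynomial.eval_ofNat, Polynomial.eval_X, Polynomial.eval_C, hlen]
      omega
    · rw [Function.update_idem]
      exact (r₂.seq r₃).congr (by simp)
    · simp [h]
  · have hn : f x = 0 := not_not.1 fun h' => h ((hpf x hx).2 h')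
    have r₃ := Cmd.runs_pushList 1 (eb no) (Function.update (fun _ => []) 1 [])
    refine ⟨_, ?_, r.seq (r₁.seq (.case_nil (by simp [hn]) (s' := Function.update (fun _ => []) 1
      (eb no)) (n := (eb no).length + 1) ?_)) |>.congr ?_⟩
    · simp only [Polynomial.eval_add, Polynomial.eval_mul,
        Polynomial.eval_ofNat, Polynomial.eval_X, Polynomial.eval_C, hlen]
      omega
    · rw [hn, List.replicate_zero]
      exact r₃.congr (by simp)
    · simp [h]

/-! ### The arithmetic criterion -/

/-- Some common multiple `k` of the `d c` is not a multiple of `ℓ` if and only if some `g < ℓ` is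
divisible by every common divisor of `ℓ` with one of the `d c`. For one direction take
`g = gcd ℓ k`, for the other take for `k` the least common multiple of the `d c`. The second
condition involves numbers up to `ℓ` and the `d c` only, whereas `k` may be exponentially large. -/
theorem exists_forall_dvd_and_not_dvd_iff {ι : Type} [Fintype ι] {d : ι → ℕ} (hd : ∀ c, 0 < d c)
    {ℓ : ℕ} (hℓ : 0 < ℓ) :
    (∃ k, (∀ c, d c ∣ k) ∧ ¬ ℓ ∣ k) ↔
      ∃ g < ℓ, 1 ≤ g ∧ ∀ c t, t ∣ ℓ → t ∣ d c → t ∣ g := by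
  constructor
  · rintro ⟨k, hk, hn⟩
    refine ⟨ℓ.gcd k, lt_of_le_of_ne (Nat.gcd_le_left k hℓ) fun h => hn ?_,
      Nat.gcd_pos_of_pos_left k hℓ, fun c t h₁ h₂ => Nat.dvd_gcd h₁ (h₂.trans (hk c))⟩
    exact h ▸ Nat.gcd_dvd_right ℓ k
  · rintro ⟨g, hg, hg₁, h⟩
    refine ⟨Finset.univ.lcm d, fun c => Finset.dvd_lcm (Finset.mem_univ c), fun hdvd => ?_⟩
    have hne : Finset.univ.lcm d ≠ 0 := fun h0 => by
      obtain ⟨c, _, hc⟩ := Finset.lcm_eq_zero_iff.1 h0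
      exact (hd c).ne' hc
    -- Every prime power dividing `ℓ` divides the lcm, hence one of the `d c`, hence `g`.
    refine absurd (Nat.le_of_dvd hg₁ ((Nat.dvd_iff_prime_pow_dvd_dvd g ℓ).2 ?_)) (by omega)
    intro p k hp hpk
    rcases Nat.eq_zero_or_pos k with rfl | hk
    · simp
    have h₁ := (hp.pow_dvd_iff_le_factorization hne).1 (hpk.trans hdvd)
    rw [Finset.factorization_lcm fun c _ => (hd c).ne', Finset.le_sup_iff (by simpa using hk)] at h₁
    obtain ⟨c, _, hc⟩ := h₁
    exact h c _ hpk ((hp.pow_dvd_iff_le_factorization (hd c).ne').2 hc)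

/-- The left shift of sequences. -/
def leftShift (x : ℕ → Prop) : ℕ → Prop := fun i => x (i + 1)

theorem leftShift_iterate (k : ℕ) (x : ℕ → Prop) : leftShift^[k] x = fun i => x (i + k) := by
  induction k generalizing x with
  | zero => rfl
  | succ k ih =>
    rw [Function.iterate_succ_apply, ih]
    funext i
    simp only [leftShift]
    congr 1

theorem isPeriodicPt_leftShift {k : ℕ} {x : ℕ → Prop} :
    Function.IsPeriodicPt leftShift k x ↔ ∀ i, x (i + k) ↔ x i := by
  rw [Function.IsPeriodicPt, Function.IsFixedPt, leftShift_iterate, funext_iff]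
  simp only [eq_iff_iff]

theorem minimalPeriod_le_card {β : Type} [Fintype β] (f : β → β) (b : β) :
    Function.minimalPeriod f b ≤ Fintype.card β := by
  classical
  rw [← Finset.card_range (Function.minimalPeriod f b), ← Finset.card_univ]
  refine Finset.card_le_card_of_injOn (fun k => f^[k] b)
    (fun _ _ => Finset.mem_coe.2 (Finset.mem_univ _)) ?_
  intro i hi j hj hij
  exact Function.iterate_injOn_Iio_minimalPeriod (by simpa using hi) (by simpa using hj) hij

theorem minimalPeriod_perm_pos {β : Type} [Finite β] (σ : Equiv.Perm β) (b : β) :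
    0 < Function.minimalPeriod σ b :=
  Function.minimalPeriod_pos_of_mem_periodicPts (σ.injective.mem_periodicPts b)

namespace CGAInstance

variable (I : CGAInstance)

/-- The sequence of adjacencies met when `u` and `v` are moved simultaneously by the
permutation. -/
def trace (u v : Fin I.n) : ℕ → Prop := fun i => I.graph.Adj (I.perm^[i] u) (I.perm^[i] v)

theorem isPeriodicPt_trace (u v : Fin I.n) :
    Function.IsPeriodicPt leftShift
      (Function.minimalPeriod I.perm u * Function.minimalPeriod I.perm v) (I.trace u v) := by
  rw [isPeriodicPt_leftShift]
  intro i
  have hu : I.perm^[Function.minimalPeriod I.perm u * Function.minimalPeriod I.perm v] u = u :=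
    (Function.isPeriodicPt_minimalPeriod I.perm u).mul_const _
  have hv : I.perm^[Function.minimalPeriod I.perm u * Function.minimalPeriod I.perm v] v = v :=
    (Function.isPeriodicPt_minimalPeriod I.perm v).const_mul _
  simp only [trace, Function.iterate_add_apply, hu, hv]

/-- The least period of the trace of a pair of vertices. -/
noncomputable def period (u v : Fin I.n) : ℕ := Function.minimalPeriod leftShift (I.trace u v)

theorem period_pos (u v : Fin I.n) : 0 < I.period u v :=
  (I.isPeriodicPt_trace u v).minimalPeriod_pos
    (Nat.mul_pos (minimalPeriod_perm_pos _ _) (minimalPeriod_perm_pos _ _))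

theorem period_le (u v : Fin I.n) : I.period u v ≤ I.n * I.n := by
  refine ((I.isPeriodicPt_trace u v).minimalPeriod_le
    (Nat.mul_pos (minimalPeriod_perm_pos _ _) (minimalPeriod_perm_pos _ _))).trans ?_
  have h := fun u => minimalPeriod_le_card I.perm u
  rw [Fintype.card_fin] at h
  exact Nat.mul_le_mul (h u) (h v)

/-- A power of the permutation preserves the graph if and only if its exponent is a multiple of the
periods of all traces, and it moves `w` if and only if its exponent is not a multiple of the length
of the cycle of `w`. -/
theorem hasCyclicAutomorphism_iff_exists_exponent :
    I.HasCyclicAutomorphism ↔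
      ∃ w, ∃ k : ℕ, (∀ c : Fin I.n × Fin I.n, I.period c.1 c.2 ∣ k) ∧
        ¬ Function.minimalPeriod I.perm w ∣ k := by
  have hdvd : ∀ k u v, I.period u v ∣ k ↔ ∀ i, I.trace u v (i + k) ↔ I.trace u v i := by
    intro k u v
    rw [period, ← Function.isPeriodicPt_iff_minimalPeriod_dvd, isPeriodicPt_leftShift]
  have hpow : ∀ (k : ℕ) u, (I.perm ^ k) u = I.perm^[k] u := fun k u => by
    rw [Equiv.Perm.iterate_eq_pow]
  constructor
  · rintro ⟨τ, hτ, hne⟩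
    rw [← mem_powers_iff_mem_zpowers] at hτ
    obtain ⟨k, hk⟩ := hτ
    have hτk : ∀ u, τ u = I.perm^[k] u := fun u => by
      rw [← hpow]
      exact (Equiv.congr_fun hk u).symm
    obtain ⟨w, hw⟩ : ∃ w, τ w ≠ w := by
      by_contra! h
      exact hne (Equiv.ext h)
    refine ⟨w, k, fun c => (hdvd _ _ _).2 fun i => ?_, fun h => hw ?_⟩
    · have := τ.map_adj_iff (v := I.perm^[i] c.1) (w := I.perm^[i] c.2)
      rw [hτk, hτk, ← Function.iterate_add_apply, ← Function.iterate_add_apply,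
        Nat.add_comm] at this
      exact this
    · rw [hτk]
      exact Function.isPeriodicPt_iff_minimalPeriod_dvd.2 h
  · rintro ⟨w, k, hk, hw⟩
    refine ⟨⟨I.perm ^ k, fun {u v} => ?_⟩, ⟨k, by simp⟩, fun h => hw ?_⟩
    · have := (hdvd k u v).1 (hk (u, v)) 0
      simp only [trace, Nat.zero_add, Function.iterate_zero, id] at this
      rw [hpow, hpow]
      exact this
    · rw [← Function.isPeriodicPt_iff_minimalPeriod_dvd]
      have := Equiv.congr_fun h w
      exact (hpow k w).symm.trans this

/-- The criterion in terms of numbers bounded by the length of the encoding. -/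
theorem hasCyclicAutomorphism_iff :
    I.HasCyclicAutomorphism ↔
      ∃ w, ∃ g < Function.minimalPeriod I.perm w, 1 ≤ g ∧ ∀ u v t,
        t ∣ Function.minimalPeriod I.perm w → t ∣ I.period u v → t ∣ g := by
  rw [hasCyclicAutomorphism_iff_exists_exponent]
  refine exists_congr fun w => ?_
  have := exists_forall_dvd_and_not_dvd_iff (d := fun c : Fin I.n × Fin I.n => I.period c.1 c.2)
    (fun c => I.period_pos c.1 c.2) (minimalPeriod_perm_pos I.perm w)
  simpa only [Prod.forall] using this

end CGAInstance

/-! ### Reading the encoding of an instance -/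

/-- The letter of `w` at position `i` exists and is a `1`. -/
def IsOne (w : List Bool) (i : ℕ) : Prop := w[i]? = some true

/-- The length of the initial block of ones: the number of vertices. -/
noncomputable def vertexCount (w : List Bool) : ℕ := least (fun i => ¬ IsOne w i) w.length

/-- The position of the first zero from position `s` on. -/
noncomputable def nextZero (w : List Bool) (s : ℕ) : ℕ :=
  least (fun i => s ≤ i ∧ ¬ IsOne w i) w.length

/-- The position at which the adjacency matrix starts. -/
noncomputable def matrixStart (w : List Bool) : ℕ := satAdd w.length (vertexCount w) 1

/-- The position at which the values of the permutation start. -/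
noncomputable def permStart (w : List Bool) : ℕ :=
  satAdd w.length (matrixStart w) (satMul w.length (vertexCount w) (vertexCount w))

/-- The position just behind the first zero from position `s` on. -/
noncomputable def skipUnary (w : List Bool) (s : ℕ) : ℕ := satAdd w.length (nextZero w s) 1

/-- The image of a vertex `u` under the permutation: behind the first `u` unary codes, the number of
ones up to the next zero. -/
noncomputable def permImage (w : List Bool) (u : ℕ) : ℕ :=
  nextZero w ((skipUnary w)^[u] (permStart w)) - (skipUnary w)^[u] (permStart w)

/-- Adjacency of two vertices. -/
def Adjacent (w : List Bool) (u v : ℕ) : Prop :=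
  IsOne w (satAdd w.length (matrixStart w) (satAdd w.length (satMul w.length u (vertexCount w)) v))

/-- The length of the cycle of a vertex. -/
noncomputable def cycleLength (w : List Bool) (a : ℕ) : ℕ :=
  least (fun k => 1 ≤ k ∧ (permImage w)^[k] a = a) w.length

/-- The least period of the trace of a pair of vertices. -/
noncomputable def tracePeriod (w : List Bool) (u v : ℕ) : ℕ :=
  least (fun k => 1 ≤ k ∧ ∀ i < w.length,
    (Adjacent w ((permImage w)^[i] ((permImage w)^[k] u))
        ((permImage w)^[i] ((permImage w)^[k] v)) ↔
      Adjacent w ((permImage w)^[i] u) ((permImage w)^[i] v))) w.length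

/-- The criterion for the existence of a cyclic automorphism, read off the encoding. -/
def Criterion (w : List Bool) : Prop :=
  ∃ a < vertexCount w, ∃ g < cycleLength w a, 1 ≤ g ∧
    ∀ u < vertexCount w, ∀ v < vertexCount w, ∀ t < w.length,
      t ∣ cycleLength w a → t ∣ tracePeriod w u v → t ∣ g

/-! ### Deciding the criterion in polynomial time -/

section Comp

variable {α : Type} [Ctx α] {f g k : α → ℕ}

theorem CompP.isOne (hf : Comp f) : CompP (fun x => IsOne (word x) (f x)) := .bit hf

theorem Comp.vertexCount : Comp (fun x : α => vertexCount (word x)) :=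
  Comp.least (p := fun x i => ¬ IsOne (word x) i) .length
    (CompP.isOne (α := α × ℕ) .snd).not

theorem Comp.nextZero (hf : Comp f) : Comp (fun x => nextZero (word x) (f x)) :=
  Comp.least (p := fun x i => f x ≤ i ∧ ¬ IsOne (word x) i) .length
    ((CompP.le hf.weaken .snd).and (CompP.isOne (α := α × ℕ) .snd).not)

theorem Comp.matrixStart : Comp (fun x : α => matrixStart (word x)) := .satAdd .vertexCount .one

theorem Comp.permStart : Comp (fun x : α => permStart (word x)) :=
  .satAdd .matrixStart (.satMul .vertexCount .vertexCount)

theorem Comp.skipUnary (hf : Comp f) : Comp (fun x => skipUnary (word x) (f x)) :=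
  .satAdd hf.nextZero .one

theorem Comp.permImage (hf : Comp f) : Comp (fun x => permImage (word x) (f x)) :=
  have h : Comp fun x => (_root_.skipUnary (word x))^[f x] (_root_.permStart (word x)) :=
    .iterate (F := fun x => _root_.skipUnary (word x)) hf .permStart
      (Comp.skipUnary (α := α × ℕ) .snd)
  h.nextZero.sub h

theorem Comp.permImage_iterate (hk : Comp k) (hf : Comp f) :
    Comp (fun x => (_root_.permImage (word x))^[k x] (f x)) :=
  .iterate (F := fun x => _root_.permImage (word x)) hk hf (Comp.permImage (α := α × ℕ) .snd)

theorem CompP.adjacent (hf : Comp f) (hg : Comp g) :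
    CompP (fun x => Adjacent (word x) (f x) (g x)) :=
  .isOne (.satAdd .matrixStart (.satAdd (.satMul hf .vertexCount) hg))

theorem Comp.cycleLength (hf : Comp f) : Comp (fun x => cycleLength (word x) (f x)) :=
  .least (p := fun x k => 1 ≤ k ∧ (_root_.permImage (word x))^[k] (f x) = f x) .length
    ((CompP.le .one .snd).and
      (CompP.eq (Comp.permImage_iterate (α := α × ℕ) .snd hf.weaken) hf.weaken))

theorem Comp.tracePeriod (hf : Comp f) (hg : Comp g) :
    Comp (fun x => tracePeriod (word x) (f x) (g x)) :=
  .least (p := fun x k => 1 ≤ k ∧ ∀ i < (word x).length,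
      (Adjacent (word x) ((_root_.permImage (word x))^[i] ((_root_.permImage (word x))^[k] (f x)))
        ((_root_.permImage (word x))^[i] ((_root_.permImage (word x))^[k] (g x))) ↔
      Adjacent (word x) ((_root_.permImage (word x))^[i] (f x))
        ((_root_.permImage (word x))^[i] (g x)))) .length
    ((CompP.le .one .snd).and (CompP.forall_lt (α := α × ℕ) (n := fun y => len y)
      (p := fun y i => (Adjacent (word y)
        ((_root_.permImage (word y))^[i] ((_root_.permImage (word y))^[y.2] (f y.1)))
        ((_root_.permImage (word y))^[i] ((_root_.permImage (word y))^[y.2] (g y.1))) ↔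
          Adjacent (word y) ((_root_.permImage (word y))^[i] (f y.1))
            ((_root_.permImage (word y))^[i] (g y.1)))) .length
      (CompP.iff (α := (α × ℕ) × ℕ)
        (.adjacent (.permImage_iterate .snd
            (.permImage_iterate (Comp.snd (α := α)).weaken hf.weaken.weaken))
          (.permImage_iterate .snd
            (.permImage_iterate (Comp.snd (α := α)).weaken hg.weaken.weaken)))
        (.adjacent (.permImage_iterate .snd hf.weaken.weaken)
          (.permImage_iterate .snd hg.weaken.weaken)))))

theorem CompP.criterion : CompP (fun x : α => Criterion (word x)) := by
  -- The context is extended by the variables `a`, `g`, `u`, `v` and `t`, in this order.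
  have a₂ : Comp fun y : (α × ℕ) × ℕ => y.1.2 := Comp.snd.weaken
  have g₂ : Comp fun y : (α × ℕ) × ℕ => y.2 := Comp.snd
  have h : CompP fun y : ((((α × ℕ) × ℕ) × ℕ) × ℕ) × ℕ =>
      y.2 ∣ _root_.cycleLength (word y) y.1.1.1.1.2 →
        y.2 ∣ _root_.tracePeriod (word y) y.1.1.2 y.1.2 → y.2 ∣ y.1.1.1.2 :=
    .imp (.dvd .snd (.cycleLength a₂.weaken.weaken.weaken))
      (.imp (.dvd .snd (.tracePeriod Comp.snd.weaken.weaken Comp.snd.weaken))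
        (.dvd .snd g₂.weaken.weaken.weaken))
  have h₁ := CompP.forall_lt (α := (((α × ℕ) × ℕ) × ℕ) × ℕ) (p := fun y t =>
    t ∣ _root_.cycleLength (word y) y.1.1.1.2 →
      t ∣ _root_.tracePeriod (word y) y.1.2 y.2 → t ∣ y.1.1.2) .length h
  have h₂ := CompP.forall_lt (α := ((α × ℕ) × ℕ) × ℕ) (p := fun y v => ∀ t < (word y).length,
    t ∣ _root_.cycleLength (word y) y.1.1.2 →
      t ∣ _root_.tracePeriod (word y) y.2 v → t ∣ y.1.2) .vertexCount h₁
  have h₃ := CompP.forall_lt (α := (α × ℕ) × ℕ) (p := fun y u => ∀ v < _root_.vertexCount (word y),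
    ∀ t < (word y).length, t ∣ _root_.cycleLength (word y) y.1.2 →
      t ∣ _root_.tracePeriod (word y) u v → t ∣ y.2) .vertexCount h₂
  have h₄ := CompP.exists_lt (α := α × ℕ) (p := fun y g => 1 ≤ g ∧
    ∀ u < _root_.vertexCount (word y), ∀ v < _root_.vertexCount (word y), ∀ t < (word y).length,
      t ∣ _root_.cycleLength (word y) y.2 → t ∣ _root_.tracePeriod (word y) u v → t ∣ g)
    (.cycleLength .snd) ((CompP.le .one .snd).and h₃)
  exact CompP.exists_lt (p := fun x a => ∃ g < _root_.cycleLength (word x) a, 1 ≤ g ∧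
    ∀ u < _root_.vertexCount (word x), ∀ v < _root_.vertexCount (word x), ∀ t < (word x).length,
      t ∣ _root_.cycleLength (word x) a → t ∣ _root_.tracePeriod (word x) u v → t ∣ g)
    .vertexCount h₄

end Comp

/-! ### Correctness of the reading functions -/

theorem nextZero_eq (w₁ w₂ : List Bool) (a : ℕ) :
    nextZero (w₁ ++ (unaryCode a ++ w₂)) w₁.length = w₁.length + a := by
  have hget : ∀ j ≤ a, (w₁ ++ (unaryCode a ++ w₂))[w₁.length + j]? = some (decide (j < a)) := by
    intro j hj
    rw [List.getElem?_append_right (by omega), Nat.add_sub_cancel_left,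
      List.getElem?_append_left (by simp [unaryCode]; omega), unaryCode]
    rcases Nat.lt_or_eq_of_le hj with h | rfl
    · rw [List.getElem?_append_left (by simpa using h)]
      simp [h]
    · rw [List.getElem?_append_right (by simp)]
      simp
  refine least_eq (by simp [unaryCode]) ⟨by omega, ?_⟩ ?_
  · rw [IsOne, hget a le_rfl]
    simp
  · rintro j hj ⟨h₁, h₂⟩
    obtain ⟨i, rfl⟩ := Nat.exists_eq_add_of_le h₁
    refine h₂ ?_
    rw [IsOne, hget i (by omega)]
    simp
    omega

theorem skipUnary_eq (w₁ w₂ : List Bool) (a : ℕ) :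
    skipUnary (w₁ ++ (unaryCode a ++ w₂)) w₁.length = (w₁ ++ unaryCode a).length := by
  rw [skipUnary, nextZero_eq, satAdd]
  simp [unaryCode]
  omega

/-- Skipping unary codes one after the other finds the next value in a list of unary codes. -/
theorem nextZero_skipUnary_iterate (l : List ℕ) : ∀ (w₁ : List Bool) (u : ℕ) (hu : u < l.length),
    nextZero (w₁ ++ l.flatMap unaryCode)
        ((skipUnary (w₁ ++ l.flatMap unaryCode))^[u] w₁.length) =
      (skipUnary (w₁ ++ l.flatMap unaryCode))^[u] w₁.length + l[u] := by
  induction l with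
  | nil => intro _ u hu; simp at hu
  | cons a l ih =>
    intro w₁ u hu
    rw [List.flatMap_cons]
    cases u with
    | zero => exact nextZero_eq w₁ _ a
    | succ u =>
      have := ih (w₁ ++ unaryCode a) u (by simpa using hu)
      rw [List.append_assoc] at this
      rw [Function.iterate_succ_apply, skipUnary_eq, List.getElem_cons_succ]
      exact this

theorem getElem?_product {β γ : Type} (l₁ : List β) (l₂ : List γ) {i j : ℕ} (hi : i < l₁.length)
    (hj : j < l₂.length) : (l₁ ×ˢ l₂)[i * l₂.length + j]? = some (l₁[i], l₂[j]) := by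
  induction l₁ generalizing i with
  | nil => simp at hi
  | cons a l₁ ih =>
    rw [List.product_cons]
    cases i with
    | zero =>
      rw [List.getElem?_append_left (by simpa using hj)]
      simp [hj]
    | succ i =>
      rw [List.getElem?_append_right (by simp; nlinarith)]
      have := ih (i := i) (by simpa using hi)
      rw [List.length_map, show (i + 1) * l₂.length + j - l₂.length = i * l₂.length + j by
        rw [Nat.succ_mul]; omega]
      simpa using this

namespace CGAInstance

variable (I : CGAInstance)

/-- An instance as a context without variables, whose input word is its encoding. -/
noncomputable instance : Ctx CGAInstance where
  word := code
  size := 0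
  val _ _ := 0
  length_pos I := by simp [code, unaryCode]

open Classical in
/-- The adjacency matrix, row by row. -/
noncomputable def matrixCode : List Bool :=
  (List.finRange I.n ×ˢ List.finRange I.n).map (fun p => decide (I.graph.Adj p.1 p.2))

/-- The list of the values of the permutation. -/
def values : List ℕ := (List.finRange I.n).map fun u => (I.perm u : ℕ)

theorem code_eq : I.code = unaryCode I.n ++ (I.matrixCode ++ I.values.flatMap unaryCode) := by
  rw [values, List.flatMap_map]
  rfl

theorem length_matrixCode : I.matrixCode.length = I.n * I.n := by
  rw [matrixCode, List.length_map]
  exact (List.length_product ..).trans (by simp)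

theorem length_code : I.n + 1 + I.n * I.n ≤ I.code.length := by
  simp only [code_eq, List.length_append, length_matrixCode, unaryCode, List.length_replicate,
    List.length_singleton]
  omega

theorem vertexCount_code : vertexCount I.code = I.n := by
  have h := nextZero_eq [] (I.matrixCode ++ I.values.flatMap unaryCode) I.n
  rw [List.nil_append, ← code_eq, List.length_nil, Nat.zero_add] at h
  rw [vertexCount, ← h, nextZero]
  simp

theorem matrixStart_code : matrixStart I.code = I.n + 1 := by
  have := I.length_code
  rw [matrixStart, vertexCount_code, satAdd]
  omega

theorem permStart_code : permStart I.code = I.n + 1 + I.n * I.n := by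
  have := I.length_code
  rw [permStart, matrixStart_code, vertexCount_code, satAdd, satMul]
  omega

theorem permImage_code (u : Fin I.n) : permImage I.code u = I.perm u := by
  have h := nextZero_skipUnary_iterate I.values (unaryCode I.n ++ I.matrixCode) u
    (by simp [values])
  have hl : (unaryCode I.n ++ I.matrixCode).length = permStart I.code := by
    rw [permStart_code, List.length_append, length_matrixCode]
    simp [unaryCode]
  rw [List.append_assoc, ← code_eq, hl] at h
  rw [permImage, h, Nat.add_sub_cancel_left]
  simp [values]

theorem permImage_iterate_code (k : ℕ) (u : Fin I.n) :
    (permImage I.code)^[k] u = (I.perm^[k] u : Fin I.n) := by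
  induction k with
  | zero => rfl
  | succ k ih => rw [Function.iterate_succ_apply', Function.iterate_succ_apply', ih, permImage_code]

theorem adjacent_code (u v : Fin I.n) : Adjacent I.code u v ↔ I.graph.Adj u v := by
  have hL := I.length_code
  have hlt : (u : ℕ) * I.n + v < I.n * I.n := by
    have h₁ := u.isLt
    have h₂ := v.isLt
    nlinarith
  rw [Adjacent, matrixStart_code, vertexCount_code,
    show satAdd I.code.length (I.n + 1) (satAdd I.code.length (satMul I.code.length u I.n) v) =
      I.n + 1 + (u * I.n + v) by simp only [satAdd, satMul]; omega, IsOne, code_eq,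
    List.getElem?_append_right (by simp [unaryCode]),
    List.getElem?_append_left (by rw [length_matrixCode]; simpa [unaryCode] using hlt),
    show I.n + 1 + (u * I.n + v) - (unaryCode I.n).length = u * I.n + v by simp [unaryCode],
    matrixCode, List.getElem?_map]
  have := getElem?_product (List.finRange I.n) (List.finRange I.n) (i := u) (j := v)
    (by simp) (by simp)
  simp only [List.length_finRange] at this
  rw [this]
  simp

theorem cycleLength_code (a : Fin I.n) :
    cycleLength I.code a = Function.minimalPeriod I.perm a := by
  have hpos := minimalPeriod_perm_pos I.perm a
  have hle := minimalPeriod_le_card I.perm a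
  have hL := I.length_code
  rw [Fintype.card_fin] at hle
  refine least_eq (by omega) ⟨hpos, ?_⟩ ?_
  · rw [permImage_iterate_code, Function.iterate_minimalPeriod]
  · rintro j hj ⟨h₁, h₂⟩
    rw [permImage_iterate_code] at h₂
    exact Function.not_isPeriodicPt_of_pos_of_lt_minimalPeriod (by omega) hj (Fin.ext h₂)

theorem tracePeriod_code (u v : Fin I.n) : tracePeriod I.code u v = I.period u v := by
  have hL := I.length_code
  have hle := I.period_le u v
  have hpos := I.period_pos u v
  have hper : ∀ i, I.trace u v (i + I.period u v) ↔ I.trace u v i :=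
    isPeriodicPt_leftShift.1 (Function.isPeriodicPt_minimalPeriod leftShift (I.trace u v))
  have htr : ∀ i k, Adjacent I.code ((permImage I.code)^[i] ((permImage I.code)^[k] u))
      ((permImage I.code)^[i] ((permImage I.code)^[k] v)) ↔ I.trace u v (i + k) := fun i k => by
    rw [← Function.iterate_add_apply, ← Function.iterate_add_apply, permImage_iterate_code,
      permImage_iterate_code, adjacent_code, trace]
  have htr' : ∀ i, Adjacent I.code ((permImage I.code)^[i] u) ((permImage I.code)^[i] v) ↔
      I.trace u v i := fun i => htr i 0
  simp only [tracePeriod, htr, htr']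
  refine least_eq (by omega) ⟨hpos, fun i _ => hper i⟩ ?_
  rintro j hj ⟨h₁, h₂⟩
  refine Function.not_isPeriodicPt_of_pos_of_lt_minimalPeriod (by omega) hj
    (isPeriodicPt_leftShift.2 fun i => ?_)
  -- By periodicity it is enough to compare the trace and its shift on a full period.
  have hmod : ∀ i m, I.trace u v (i + m * I.period u v) ↔ I.trace u v i := by
    intro i m
    induction m with
    | zero => simp
    | succ m ih => rw [Nat.succ_mul, ← Nat.add_assoc, hper, ih]
  have hlt := Nat.mod_lt i hpos
  have h := h₂ (i % I.period u v) (by omega)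
  rw [← hmod _ (i / I.period u v), ← hmod (i % I.period u v) (i / I.period u v)] at h
  rwa [Nat.add_right_comm, Nat.mul_comm, Nat.mod_add_div] at h

theorem criterion_code : Criterion I.code ↔ I.HasCyclicAutomorphism := by
  rw [hasCyclicAutomorphism_iff, Criterion, vertexCount_code]
  have hL := I.length_code
  constructor
  · rintro ⟨a, ha, g, hg, hg₁, h⟩
    have e := I.cycleLength_code ⟨a, ha⟩
    dsimp only at e
    rw [e] at hg h
    refine ⟨⟨a, ha⟩, g, hg, hg₁, fun u v t h₁ h₂ => h u u.isLt v v.isLt t ?_ h₁ ?_⟩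
    · have h₃ := Nat.le_of_dvd (minimalPeriod_perm_pos _ _) h₁
      have h₄ := minimalPeriod_le_card I.perm ⟨a, ha⟩
      rw [Fintype.card_fin] at h₄
      omega
    · rwa [tracePeriod_code]
  · rintro ⟨a, g, hg, hg₁, h⟩
    refine ⟨a, a.isLt, g, ?_, hg₁, fun u hu v hv t _ h₁ h₂ => h ⟨u, hu⟩ ⟨v, hv⟩ t ?_ ?_⟩
    · rwa [cycleLength_code]
    · rwa [cycleLength_code] at h₁
    · rwa [← tracePeriod_code]

end CGAInstance

/-! ### Two circuits with a certain outcome -/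

namespace QCircuit

/-- The circuit without gates, on the output qubit alone. -/
def reject : QCircuit := ⟨0, []⟩

/-- The circuit `H T T T T H = H Z H = X` on the output qubit alone. -/
def accept : QCircuit :=
  ⟨0, [.hadamard 0, .tgate 0, .tgate 0, .tgate 0, .tgate 0, .hadamard 0]⟩

/-- The state `a |0⟩ + b |1⟩` of a single qubit. -/
def qubit (a b : ℂ) : (Fin (0 + 1) → Bool) → ℂ := fun x => if x 0 then b else a

theorem single_eq_qubit :
    (Pi.single (fun _ => false) 1 : (Fin (0 + 1) → Bool) → ℂ) = qubit 1 0 := by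
  funext x
  rw [Pi.single_apply, qubit]
  have : x = (fun _ => false) ↔ x 0 = false :=
    ⟨fun h => by rw [h], fun h => funext fun j => by rw [Fin.fin_one_eq_zero j]; exact h⟩
  cases h : x 0 <;> simp [this, h]

theorem sum_qubit {M : Type} [AddCommMonoid M] (f : (Fin (0 + 1) → Bool) → M) :
    ∑ x, f x = f (fun _ => false) + f (fun _ => true) := by
  rw [← (Equiv.funUnique (Fin 1) Bool).symm.sum_comp, Fintype.sum_bool, add_comm]
  rfl

theorem onQubit_mulVec_qubit (A : Matrix Bool Bool ℂ) (a b : ℂ) :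
    (onQubit A 0).mulVec (qubit a b) =
      qubit (A false false * a + A false true * b) (A true false * a + A true true * b) := by
  funext x
  have hj : ∀ y : Fin (0 + 1) → Bool, ∀ j : Fin (0 + 1), j ≠ 0 → x j = y j := fun y j h =>
    absurd (Fin.fin_one_eq_zero j) h
  simp only [Matrix.mulVec, dotProduct, onQubit, Matrix.of_apply, if_pos (hj _), sum_qubit, qubit]
  cases x 0 <;> simp

theorem acceptProb_eq {g : List (QGate (0 + 1))} {a b : ℂ}
    (h : finalState ⟨0, g⟩ = qubit a b) : acceptProb ⟨0, g⟩ = ‖b‖ ^ 2 := by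
  simp only [acceptProb, h]
  rw [sum_qubit]
  simp [qubit]

theorem acceptProb_reject : reject.acceptProb = 0 := by
  exact (acceptProb_eq (g := []) (a := 1) (b := 0) single_eq_qubit).trans (by simp)

theorem acceptProb_accept : accept.acceptProb = 1 := by
  have h4 : Complex.exp (Real.pi / 4 * Complex.I) ^ 4 = -1 := by
    rw [← Complex.exp_nat_mul, ← Complex.exp_pi_mul_I]
    congr 1
    push_cast
    ring
  have h2 : (1 / (Real.sqrt 2 : ℂ)) * (1 / (Real.sqrt 2 : ℂ)) = 1 / 2 := by
    rw [div_mul_div_comm, one_mul, ← Complex.ofReal_mul, Real.mul_self_sqrt (by norm_num)]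
    norm_num
  have H : ∀ a b, (onQubit hadamardMatrix 0).mulVec (qubit a b) =
      qubit (1 / (Real.sqrt 2 : ℂ) * (a + b)) (1 / (Real.sqrt 2 : ℂ) * (a - b)) := fun a b => by
    rw [onQubit_mulVec_qubit]
    simp only [hadamardMatrix, Matrix.of_apply, Bool.and_self, Bool.and_false, Bool.and_true,
      if_true, Bool.false_eq_true, if_false]
    congr 1 <;> ring
  have T : ∀ a b, (onQubit tMatrix 0).mulVec (qubit a b) =
      qubit a (Complex.exp (Real.pi / 4 * Complex.I) * b) := fun a b => by
    rw [onQubit_mulVec_qubit]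
    simp [tMatrix]
  refine (acceptProb_eq (a := 0) (b := 1) ?_).trans (by simp)
  · change (onQubit hadamardMatrix 0).mulVec ((onQubit tMatrix 0).mulVec ((onQubit tMatrix 0).mulVec
      ((onQubit tMatrix 0).mulVec ((onQubit tMatrix 0).mulVec ((onQubit hadamardMatrix 0).mulVec
        (Pi.single (fun _ => false) 1 : (Fin (0 + 1) → Bool) → ℂ)))))) = qubit 0 1
    rw [single_eq_qubit, H, T, T, T, T, H]
    generalize 1 / (Real.sqrt 2 : ℂ) = s at *
    congr 1
    · linear_combination s * s * h4
    · linear_combination 2 * h2 - s * s * h4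

end QCircuit

/-! ### Membership in BQP -/

theorem mainTheorem11 :
    InBQP CGAInstance.encoding CGAInstance.HasCyclicAutomorphism := by
  classical
  have h : CompP CGAInstance.HasCyclicAutomorphism :=
    (CompP.criterion (α := CGAInstance)).congr fun I _ => I.criterion_code
  refine ⟨fun I => if I.HasCyclicAutomorphism then QCircuit.accept else QCircuit.reject,
    ?_, fun I hI => ?_, fun I hI => ?_⟩
  · convert h.nonempty_polyTime rfl QCircuit.encoding.encode QCircuit.accept QCircuit.reject
    rfl
  · simp only [if_pos hI, QCircuit.acceptProb_accept]
    norm_num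
  · simp only [if_neg hI, QCircuit.acceptProb_reject]
    norm_num
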